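/- **Setting.** A dynamic graph sequence of length $T$ on $N$ nodes is a sequence $\mathcal S=(G_1,\dots,G_T)$ of simple graphs on a fixed node set $V$, $|V|=N$, such that, with $G_0$ the empty graph, consecutive graphs $G_{t-1},G_t$ ($1\le t\le T$) differ by at most one edge insertion or deletion. Two such sequences are event-level edge-neighboring if one of them is obtained from the other by replacing by no-ops one update of some edge $e$ together with the next update of $e$ (if there is one). A continual release algorithm $\mathcal A$ with outputs in $\mathbb R^k$ is a randomized algorithm that, on input $\mathcal S$, outputs $a_t\in\mathbb R^k$ at each time step $t\in\{1,\dots,T\}$, the outputs up to time $t$ depending only on $G_1,\dots,G_t$; write $\mathcal A(\mathcal S)=(a_1,\dots,a_T)$. For $f$ mapping graphs on $V$ to $\mathbb R^k$, write $f(\mathcal S)=(f(G_1),\dots,f(G_T))$. The algorithm $\mathcal A$ is * *event-level $(\varepsilon,\delta)$-edge-DP* if $\Pr[\mathcal A(\mathcal S)\in U]\le e^{\varepsilon}\Pr[\mathcal A(\mathcal S')\in U]+\delta$ for all event-level edge-neighboring $\mathcal S,\mathcal S'$ and all measurable $U\subseteq(\mathbb R^k)^T$; * *$(f,\gamma)$-output-determined*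 if $\Pr[\mathcal A(\mathcal S)\in U]\le \Pr[\mathcal A(\mathcal S')\in U]+\gamma$ for all $\mathcal S,\mathcal S'$ with $f(\mathcal S)=f(\mathcal S')$ and all measurable $U\subseteq(\mathbb R^k)^T$; * *$(\alpha,\beta)$-accurate for $f$* if $\Pr[\max_{t}\|a_t-f(G_t)\|_\infty>\alpha]\le\beta$ for every dynamic graph sequence of length $T$ on the $N$ nodes. **Theorem.** There is an absolute constant $c>0$ such that the following holds. Let $f$ be one of: the size of a maximum matching; the number of connected components; the number of nodes of degree at least $\tau$, for an integer $\tau\ge 1$; or the degree histogram $(h_0,\dots,h_{N-1})$, where $h_j$ is the number of nodes of degree $j$. Let $\varepsilon\in(0,1]$. 1. Let $\delta=\delta(T,N)\in(0,1)$ satisfy $\delta=o(1/T)$ as $T,N\to\infty$. Then there are $T_0,N_0$ (which may depend on $f$, $\tau$, $\varepsilon$ and the function $\delta$) such that for all $T\ge T_0$, $N\ge N_0$ and all $\gamma$ with $0\le\gamma\le\delta(T,N)$, every $(f,\gamma)$-output-determined, event-level $(\varepsilon,\delta(T,N))$-edge-DP algorithm for sequences of length $T$ on $N$ nodes that is $(\alpha,\tfrac13)$-accurate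 for $f$ satisfies $$\alpha\ \ge\ c\cdot\min\left(\frac{T^{1/3}}{\varepsilon^{2/3}\log_2^{2/3}T},\ T,\ N\right).$$ 2. There are $T_0,N_0$ (which may depend on $f$, $\tau$, $\varepsilon$) such that for all $T\ge T_0$, $N\ge N_0$, every $(f,0)$-output-determined, event-level $(\varepsilon,0)$-edge-DP algorithm for sequences of length $T$ on $N$ nodes that is $(\alpha,\tfrac13)$-accurate for $f$ satisfies $$\alpha\ \ge\ c\cdot\min\left(\sqrt{\frac T\varepsilon},\ T,\ N\right).$$ -/

import Mathlib

open MeasureTheory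

/-- A dynamic graph sequence `(G_1, …, G_T)` on the node set `V`: `graph 0` is the empty graph
`G_0`, `graph t` is `G_t`, and consecutive graphs differ in at most one edge. -/
structure DynamicGraphSequence (V : Type*) (T : ℕ) where
  graph : Fin (T + 1) → SimpleGraph V
  graph_zero : graph 0 = ⊥
  step : ∀ t : Fin T,
    (symmDiff (graph t.castSucc).edgeSet (graph t.succ).edgeSet).encard ≤ 1

namespace DynamicGraphSequence

variable {V : Type*} {T : ℕ}

/-- The edges inserted at a time step. A time step in `{1, …, T}` is represented by the
index `t : Fin T` such that the time step is `t + 1`. -/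
def inserted (S : DynamicGraphSequence V T) (t : Fin T) : Set (Sym2 V) :=
  (S.graph t.succ).edgeSet \ (S.graph t.castSucc).edgeSet

/-- The edges deleted at a time step. -/
def deleted (S : DynamicGraphSequence V T) (t : Fin T) : Set (Sym2 V) :=
  (S.graph t.castSucc).edgeSet \ (S.graph t.succ).edgeSet

/-- The edges updated at a time step. -/
def updated (S : DynamicGraphSequence V T) (t : Fin T) : Set (Sym2 V) :=
  S.inserted t ∪ S.deleted t

/-- `S'` arises from `S` by replacing one update of an edge `e` (at `t₁`), together with the next
update of `e` (at `t₂`) if there is one, by no-ops. The value `t₂ = T` (one past the last index)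
encodes that `e` is not updated after `t₁`; conditions at `t₂` are then void. -/
def RemovesEvent (S S' : DynamicGraphSequence V T) : Prop :=
  ∃ (e : Sym2 V) (t₁ : Fin T) (t₂ : ℕ), (t₁ : ℕ) < t₂ ∧ t₂ ≤ T ∧
    (∀ t : Fin T, t ≠ t₁ → (t : ℕ) ≠ t₂ →
      S.inserted t = S'.inserted t ∧ S.deleted t = S'.deleted t) ∧
    (∀ t : Fin T, t₁ < t → (t : ℕ) < t₂ → e ∉ S.updated t) ∧
    ((S.inserted t₁ = {e} ∧ ∀ t : Fin T, (t : ℕ) = t₂ → S.deleted t = {e}) ∨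
      (S.deleted t₁ = {e} ∧ ∀ t : Fin T, (t : ℕ) = t₂ → S.inserted t = {e})) ∧
    S'.updated t₁ = ∅ ∧ (∀ t : Fin T, (t : ℕ) = t₂ → S'.updated t = ∅)

/-- Event-level, edge-neighboring dynamic graph sequences. -/
def EventNeighboring (S S' : DynamicGraphSequence V T) : Prop :=
  S.RemovesEvent S' ∨ S'.RemovesEvent S

/-- The output sequence `(f(G_1), …, f(G_T))` of a graph function. -/
def outputs {β : Type*} (f : SimpleGraph V → β) (S : DynamicGraphSequence V T) : Fin T → β :=
  fun t => f (S.graph t.succ)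

end DynamicGraphSequence

/-- A (randomized) continual release graph algorithm with outputs in `ℝ^k` at each of `T` time
steps, given by the law of its output sequence on every dynamic graph sequence. The field `causal`
says that the outputs up to a time step depend only on the graphs up to that time step. -/
structure ContinualReleaseAlgorithm (V : Type*) (T k : ℕ) where
  law : DynamicGraphSequence V T → Measure (Fin T → Fin k → ℝ)
  isProbabilityMeasure_law : ∀ S, IsProbabilityMeasure (law S)
  causal : ∀ (S S' : DynamicGraphSequence V T) (t : Fin T),
    (∀ s ≤ t, S.graph s.succ = S'.graph s.succ) →
      (law S).map (fun a (s : Set.Iic t) => a s) = (law S').map (fun a (s : Set.Iic t) => a s)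

namespace ContinualReleaseAlgorithm

variable {V : Type*} {T k : ℕ}

/-- Event-level `(ε, δ)`-edge differential privacy. -/
def IsEventLevelEdgeDP (A : ContinualReleaseAlgorithm V T k) (ε δ : ℝ) : Prop :=
  ∀ S S' : DynamicGraphSequence V T, S.EventNeighboring S' →
    ∀ U : Set (Fin T → Fin k → ℝ), MeasurableSet U →
      (A.law S).real U ≤ Real.exp ε * (A.law S').real U + δ

/-- `(f, γ)`-output-determined algorithms. -/
def IsOutputDetermined {β : Type*} (A : ContinualReleaseAlgorithm V T k)
    (f : SimpleGraph V → β) (γ : ℝ) : Prop :=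
  ∀ S S' : DynamicGraphSequence V T, S.outputs f = S'.outputs f →
    ∀ U : Set (Fin T → Fin k → ℝ), MeasurableSet U →
      (A.law S).real U ≤ (A.law S').real U + γ

/-- `(α, β)`-accuracy for `f` on all dynamic graph sequences; the norm on `Fin k → ℝ` is the
maximum norm. -/
def IsAccurate (A : ContinualReleaseAlgorithm V T k)
    (f : SimpleGraph V → Fin k → ℝ) (α β : ℝ) : Prop :=
  ∀ S : DynamicGraphSequence V T,
    (A.law S).real {a | ∃ t : Fin T, α < ‖a t - S.outputs f t‖} ≤ β

end ContinualReleaseAlgorithm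

namespace SimpleGraph

variable {V : Type*} [Fintype V]

/-- The size of a maximum matching. -/
noncomputable def maxMatchingSize (G : SimpleGraph V) : ℕ :=
  sSup {n | ∃ M : G.Subgraph, M.IsMatching ∧ M.edgeSet.ncard = n}

/-- The number of connected components. -/
noncomputable def numComponents (G : SimpleGraph V) : ℕ :=
  Nat.card G.ConnectedComponent

open scoped Classical in
/-- The number of nodes of degree at least `τ`. -/
noncomputable def highDegreeCount (τ : ℕ) (G : SimpleGraph V) : ℕ :=
  (Finset.univ.filter fun v => τ ≤ G.degree v).card

open scoped Classical in
/-- The number of nodes of degree exactly `j`. -/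
noncomputable def degreeCount (j : ℕ) (G : SimpleGraph V) : ℕ :=
  (Finset.univ.filter fun v => G.degree v = j).card

end SimpleGraph

/-- The four graph problems. -/
inductive GraphProblem where
  | maximumMatching : GraphProblem
  | connectedComponents : GraphProblem
  | highDegree (τ : ℕ+) : GraphProblem
  | degreeHistogram : GraphProblem

/-- The dimension of the output on graphs with `N` nodes. -/
def GraphProblem.dim : GraphProblem → ℕ → ℕ
  | maximumMatching, _ => 1
  | connectedComponents, _ => 1
  | highDegree _, _ => 1
  | degreeHistogram, N => N

/-- The graph function of a problem on graphs with `N` nodes; for the degree histogram this is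
the vector `(h_0, …, h_{N-1})`. -/
noncomputable def GraphProblem.value :
    (P : GraphProblem) → (N : ℕ) → SimpleGraph (Fin N) → Fin (P.dim N) → ℝ
  | maximumMatching, _, G => fun _ => (G.maxMatchingSize : ℝ)
  | connectedComponents, _, G => fun _ => (G.numComponents : ℝ)
  | highDegree τ, _, G => fun _ => (G.highDegreeCount τ : ℝ)
  | degreeHistogram, _, G => fun j => (G.degreeCount j : ℝ)

/-! ### Finite product weights -/

/-! A private algorithm for `f` is turned into a private mechanism for the `d` column sums of a
binary data set with `n` records, a problem with known obstructions. Record `i` becomes a gadget. In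
phase `j` every gadget receives the toggle edge selected by bit `(i, j)`; once all are present, one
coordinate of `f` is a constant plus the `j`-th column sum, and then they are deleted again.

Changing one record may alter updates in all `d` phases, for which edge privacy alone would charge
`d` times. The probe edge avoids this: inserting it is a single event, and while it is present `f`
cannot see which toggle edge its gadget carries. Insert the probe, exchange the record by
output-determinedness, remove the probe: the cost is `exp (2 * ε)` and an additive `exp ε * (δ + γ)
+ δ`, independent of `d` (`Gadget.IsHiding.isPrivateMarginals`, with the gadgets of
`Gadget.exists_isHiding`).

For approximate privacy, marginals are bounded by fingerprinting. Draw column means uniformly and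
then independent records. Accurate answers must correlate with their columns
(`fingerprinting_column`), whereas privacy makes each record behave almost like a fresh one, whose
correlation with the answers has mean zero and mean absolute value at most `√d`
(`sum_fingerprint_le`). Comparing the two gives `d ≲ (n ε)²` if `α ≤ n / 100` and `n δ` is small.
For pure privacy, packing the `2 ^ d` data sets with constant records gives `d ≲ n ε` if `α < n /
2`.

A run of length `T` accommodates `n d` of order `T`. With `n` a small multiple of the claimed bound,
`d` of order `T / n` violates these inequalities. Setting up the gadgets takes `O(n)` steps with a
factor depending on `τ`; that is absorbed into the thresholds, so `c` is absolute. -/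

theorem prod_update_mul {ι X : Type*} [Fintype ι] [DecidableEq ι] (r : ι → X → ℝ) (i : ι) (y : ι → X) (v : X) :
    (∏ k, r k (Function.update y i v k)) * r i (y i) = (∏ k, r k (y k)) * r i v := by
  rw [← Finset.mul_prod_erase Finset.univ (fun k => r k (Function.update y i v k))
    (Finset.mem_univ i), ← Finset.mul_prod_erase Finset.univ (fun k => r k (y k))
    (Finset.mem_univ i)]
  have : ∏ k ∈ Finset.univ.erase i, r k (Function.update y i v k) =
      ∏ k ∈ Finset.univ.erase i, r k (y k) := by
    refine Finset.prod_congr rfl fun k hk => ?_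
    rw [Function.update_of_ne (Finset.ne_of_mem_erase hk)]
  rw [this]
  simp only [Function.update_self]
  ring

section ProductWeights

variable {ι X : Type*} [Fintype ι] [Fintype X] [DecidableEq ι]

theorem sum_prod_weight_eq_one {r : ι → X → ℝ} (hr : ∀ i, ∑ x, r i x = 1) :
    ∑ y : ι → X, ∏ i, r i (y i) = 1 := by
  rw [← Fintype.prod_sum]
  simp [hr]

/-- Exchanging the coordinate `i` of a product-distributed point with an independent copy. -/
theorem sum_prod_weight_swap (r : ι → X → ℝ) (i : ι) (H : (ι → X) → X → ℝ) :
    ∑ y : ι → X, ∑ v, (∏ k, r k (y k)) * r i v * H y v =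
      ∑ y : ι → X, ∑ v, (∏ k, r k (y k)) * r i v * H (Function.update y i v) (y i) := by
  rw [← Fintype.sum_prod_type', ← Fintype.sum_prod_type']
  have hinv : Function.Involutive
      (fun p : (ι → X) × X => (Function.update p.1 i p.2, p.1 i)) := by
    rintro ⟨y, v⟩
    simp
  refine Fintype.sum_equiv hinv.toPerm _ _ ?_
  rintro ⟨y, v⟩
  simp only [Function.Involutive.coe_toPerm, Function.update_self, Function.update_idem,
    Function.update_eq_self]
  rw [prod_update_mul]

theorem sum_prod_weight_resample {r : ι → X → ℝ} (i : ι) (hr : ∑ x, r i x = 1)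
    (G : (ι → X) → ℝ) :
    ∑ y : ι → X, (∏ k, r k (y k)) * G y =
      ∑ y : ι → X, (∏ k, r k (y k)) * ∑ v, r i v * G (Function.update y i v) := by
  have h := sum_prod_weight_swap r i (fun y _ => G y)
  calc ∑ y : ι → X, (∏ k, r k (y k)) * G y
      = ∑ y : ι → X, ∑ v, (∏ k, r k (y k)) * r i v * G y := by
        refine Finset.sum_congr rfl fun y _ => ?_
        rw [← Finset.sum_mul, ← Finset.mul_sum, hr, mul_one]
    _ = _ := h
    _ = _ := by
        refine Finset.sum_congr rfl fun y _ => ?_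
        rw [Finset.mul_sum]
        refine Finset.sum_congr rfl fun v _ => ?_
        ring

end ProductWeights

/-! ### Bernoulli weights -/

/-- The indicator of `true`. -/
def boolBit (b : Bool) : ℝ := if b then 1 else 0

/-- The weight of a bit under the Bernoulli distribution with mean `u`. -/
def bernoulliWeight (u : ℝ) (b : Bool) : ℝ := if b then u else 1 - u

theorem bernoulliWeight_sum (u : ℝ) : ∑ b, bernoulliWeight u b = 1 := by
  simp [bernoulliWeight]

theorem bernoulliWeight_nonneg {u : ℝ} (h0 : 0 ≤ u) (h1 : u ≤ 1) (b : Bool) :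
    0 ≤ bernoulliWeight u b := by
  cases b <;> simp [bernoulliWeight, h0, h1]

theorem sum_bernoulliWeight_sub (u : ℝ) : ∑ b, bernoulliWeight u b * (boolBit b - u) = 0 := by
  simp [bernoulliWeight, boolBit]; ring

section Record

variable {d : ℕ}

/-- The weight of a record with independent Bernoulli attributes of means `u j`. -/
def recordWeight (u : Fin d → ℝ) (v : Fin d → Bool) : ℝ := ∏ j, bernoulliWeight (u j) (v j)

theorem recordWeight_sum (u : Fin d → ℝ) : ∑ v, recordWeight u v = 1 :=
  sum_prod_weight_eq_one fun _ => bernoulliWeight_sum _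

theorem recordWeight_nonneg {u : Fin d → ℝ} (h0 : ∀ j, 0 ≤ u j) (h1 : ∀ j, u j ≤ 1)
    (v : Fin d → Bool) : 0 ≤ recordWeight u v :=
  Finset.prod_nonneg fun j _ => bernoulliWeight_nonneg (h0 j) (h1 j) _

theorem sum_recordWeight_coord (u : Fin d → ℝ) (j : Fin d) (g : Bool → ℝ) :
    ∑ v, recordWeight u v * g (v j) = ∑ b, bernoulliWeight (u j) b * g b := by
  have h := sum_prod_weight_resample (r := fun j => bernoulliWeight (u j)) j
    (bernoulliWeight_sum _) (fun v => g (v j))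
  simp only [Function.update_self] at h
  rw [← Finset.sum_mul] at h
  rw [show ∑ v, recordWeight u v * g (v j) = _ from h,
    sum_prod_weight_eq_one fun _ => bernoulliWeight_sum _, one_mul]

theorem sum_recordWeight_linear (u c : Fin d → ℝ) :
    ∑ v, recordWeight u v * ∑ j, c j * (boolBit (v j) - u j) = 0 := by
  simp only [Finset.mul_sum]
  rw [Finset.sum_comm]
  refine Finset.sum_eq_zero fun j _ => ?_
  have h := sum_recordWeight_coord u j (fun b => boolBit b - u j)
  rw [sum_bernoulliWeight_sub] at h
  rw [← mul_zero (c j), ← h, Finset.mul_sum]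
  refine Finset.sum_congr rfl fun v _ => ?_
  ring

theorem sum_recordWeight_cross (u : Fin d → ℝ) {j k : Fin d} (hjk : j ≠ k) :
    ∑ v, recordWeight u v * ((boolBit (v j) - u j) * (boolBit (v k) - u k)) = 0 := by
  have h := sum_prod_weight_resample (r := fun j => bernoulliWeight (u j)) j
    (bernoulliWeight_sum _) (fun v => (boolBit (v j) - u j) * (boolBit (v k) - u k))
  refine Eq.trans h (Finset.sum_eq_zero fun v _ => ?_)
  simp only [Function.update_self, Function.update_of_ne hjk.symm]
  simp only [← mul_assoc]
  rw [← Finset.sum_mul, sum_bernoulliWeight_sub]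
  simp

/-- Independence kills the cross terms, and each coordinate has variance at most 1. -/
theorem sum_recordWeight_sq_le (u c : Fin d → ℝ) (hc : ∀ j, |c j| ≤ 1) :
    ∑ v, recordWeight u v * (∑ j, c j * (boolBit (v j) - u j)) ^ 2 ≤ d := by
  have key : ∑ v, recordWeight u v * (∑ j, c j * (boolBit (v j) - u j)) ^ 2 =
      ∑ j, c j ^ 2 * (u j * (1 - u j)) := by
    have h1 : ∀ v, recordWeight u v * (∑ j, c j * (boolBit (v j) - u j)) ^ 2 =
        ∑ j, ∑ k, c j * c k *
          (recordWeight u v * ((boolBit (v j) - u j) * (boolBit (v k) - u k))) := by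
      intro v
      rw [sq, Finset.sum_mul_sum, Finset.mul_sum]
      refine Finset.sum_congr rfl fun j _ => ?_
      rw [Finset.mul_sum]
      refine Finset.sum_congr rfl fun k _ => ?_
      ring
    simp only [h1]
    rw [Finset.sum_comm]
    refine Finset.sum_congr rfl fun j _ => ?_
    rw [Finset.sum_comm, Finset.sum_eq_single j]
    · rw [← Finset.mul_sum]
      have h := sum_recordWeight_coord u j (fun b => (boolBit b - u j) * (boolBit b - u j))
      rw [h]
      simp [bernoulliWeight, boolBit]
      ring
    · intro k _ hk
      rw [← Finset.mul_sum, sum_recordWeight_cross u hk.symm, mul_zero]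
    · simp
  rw [key]
  calc ∑ j, c j ^ 2 * (u j * (1 - u j)) ≤ ∑ _j : Fin d, (1 : ℝ) := by
        refine Finset.sum_le_sum fun j _ => ?_
        have h1 : c j ^ 2 ≤ 1 := by
          rw [sq_le_one_iff_abs_le_one]; exact hc j
        have h2 : u j * (1 - u j) ≤ 1 := by nlinarith [sq_nonneg (u j - 1 / 2)]
        nlinarith [sq_nonneg (c j)]
    _ = d := by simp

/-- First moment from second moment, through `2 √d |x| ≤ x ^ 2 + d`. -/
theorem sum_recordWeight_abs_le {u : Fin d → ℝ} (h0 : ∀ j, 0 ≤ u j) (h1 : ∀ j, u j ≤ 1)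
    {c : Fin d → ℝ} (hc : ∀ j, |c j| ≤ 1) :
    ∑ v, recordWeight u v * |∑ j, c j * (boolBit (v j) - u j)| ≤ Real.sqrt d := by
  rcases Nat.eq_zero_or_pos d with rfl | hd
  · simp
  have hs : 0 < Real.sqrt d := Real.sqrt_pos.2 (by exact_mod_cast hd)
  have hsq : Real.sqrt d ^ 2 = d := Real.sq_sqrt (by positivity)
  have hmain : ∑ v, recordWeight u v * (2 * Real.sqrt d * |∑ j, c j * (boolBit (v j) - u j)|) ≤
      ∑ v, (recordWeight u v * (∑ j, c j * (boolBit (v j) - u j)) ^ 2 + recordWeight u v * d) := by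
    refine Finset.sum_le_sum fun v _ => ?_
    rw [← mul_add]
    refine mul_le_mul_of_nonneg_left ?_ (recordWeight_nonneg h0 h1 v)
    nlinarith [sq_nonneg (Real.sqrt d - |∑ j, c j * (boolBit (v j) - u j)|),
      sq_abs (∑ j, c j * (boolBit (v j) - u j))]
  rw [Finset.sum_add_distrib, ← Finset.sum_mul, recordWeight_sum, one_mul] at hmain
  have hl : ∑ v, recordWeight u v * (2 * Real.sqrt d * |∑ j, c j * (boolBit (v j) - u j)|) =
      2 * Real.sqrt d * ∑ v, recordWeight u v * |∑ j, c j * (boolBit (v j) - u j)| := by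
    rw [Finset.mul_sum]
    refine Finset.sum_congr rfl fun v _ => ?_
    ring
  rw [hl] at hmain
  have := sum_recordWeight_sq_le u c hc
  nlinarith

end Record

/-! ### The fingerprinting identity -/

section Fingerprinting

variable {n : ℕ}

/-- The derivative of `q ↦ ∏ i, bernoulliWeight q (b i)`. -/
def bernoulliProdDeriv (b : Fin n → Bool) (q : ℝ) : ℝ :=
  ∑ i, (∏ k ∈ Finset.univ.erase i, bernoulliWeight q (b k)) * (if b i then 1 else -1)

theorem hasDerivAt_bernoulliWeight (b : Bool) (q : ℝ) :
    HasDerivAt (fun q => bernoulliWeight q b) (if b then 1 else -1) q := by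
  cases b
  · simpa [bernoulliWeight] using (hasDerivAt_id' q).const_sub 1
  · simpa [bernoulliWeight] using hasDerivAt_id' q

theorem hasDerivAt_bernoulliProd (b : Fin n → Bool) (q : ℝ) :
    HasDerivAt (fun q => ∏ i, bernoulliWeight q (b i)) (bernoulliProdDeriv b q) q := by
  simpa [bernoulliProdDeriv] using
    HasDerivAt.fun_finsetProd (u := Finset.univ) (f := fun i q => bernoulliWeight q (b i))
      fun i _ => hasDerivAt_bernoulliWeight (b i) q

theorem continuous_bernoulliWeight (b : Bool) : Continuous fun q => bernoulliWeight q b :=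
  continuous_iff_continuousAt.2 fun q => (hasDerivAt_bernoulliWeight b q).continuousAt

theorem continuous_bernoulliProdDeriv (b : Fin n → Bool) : Continuous (bernoulliProdDeriv b) :=
  continuous_finsetSum _ fun _ _ =>
    (continuous_finsetProd _ fun _ _ => continuous_bernoulliWeight _).mul continuous_const

theorem mul_bernoulliProdDeriv (b : Fin n → Bool) (q : ℝ) :
    q * (1 - q) * bernoulliProdDeriv b q =
      (∏ i, bernoulliWeight q (b i)) * ∑ i, (boolBit (b i) - q) := by
  rw [bernoulliProdDeriv, Finset.mul_sum, Finset.mul_sum]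
  refine Finset.sum_congr rfl fun i _ => ?_
  rw [← Finset.mul_prod_erase Finset.univ (fun k => bernoulliWeight q (b k)) (Finset.mem_univ i)]
  have : q * (1 - q) * (if b i then 1 else -1) =
      bernoulliWeight q (b i) * (boolBit (b i) - q) := by
    cases b i <;> simp [bernoulliWeight, boolBit]; ring
  linear_combination (∏ k ∈ Finset.univ.erase i, bernoulliWeight q (b k)) * this

/-- With `G q` the mean answer at column mean `q`, the correlation is `q (1 - q) G' q`, since `∑ (b
i - q)` is `q (1 - q)` times the score of the Bernoulli product. Integrating by parts leaves `∫ (2 q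
- 1) G q`, which is bounded below because `G` stays close to a line of slope `2 / 3` through `1 /
2`. -/
theorem fingerprinting_column {Y : Type*} [Fintype Y] (c : Y → ℝ) (b : Y → Fin n → Bool)
    (h : ∀ q ∈ Set.Icc (0 : ℝ) 1,
      |(∑ y, c y * ∏ i, bernoulliWeight q (b y i)) - 2 / 3 * (q - 1 / 2)| ≤ 13 / 75) :
    1 / 100 ≤ ∫ q in (0 : ℝ)..1,
      ∑ y, c y * ((∏ i, bernoulliWeight q (b y i)) * ∑ i, (boolBit (b y i) - q)) := by
  set G : ℝ → ℝ := fun q => ∑ y, c y * ∏ i, bernoulliWeight q (b y i) with hG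
  have hGc : Continuous G := continuous_finsetSum _ fun _ _ => continuous_const.mul
    (continuous_finsetProd _ fun _ _ => continuous_bernoulliWeight _)
  set G' : ℝ → ℝ := fun q => ∑ y, c y * bernoulliProdDeriv (b y) q with hG'
  have hG'c : Continuous G' := continuous_finsetSum _ fun _ _ => continuous_const.mul
    (continuous_bernoulliProdDeriv _)
  have hder : ∀ q, HasDerivAt G (G' q) q := fun q =>
    HasDerivAt.fun_sum fun y _ => (hasDerivAt_bernoulliProd (b y) q).const_mul (c y)
  have hder2 : ∀ q : ℝ, HasDerivAt (fun q : ℝ => q * (1 - q)) (1 - 2 * q) q := by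
    intro q
    exact ((hasDerivAt_id' q).mul ((hasDerivAt_id' q).const_sub 1)).congr_deriv (by ring)
  have hparts := intervalIntegral.integral_mul_deriv_eq_deriv_mul (a := 0) (b := 1)
    (fun q _ => hder2 q) (fun q _ => hder q)
    ((by fun_prop : Continuous fun q : ℝ => 1 - 2 * q).intervalIntegrable _ _)
    (hG'c.intervalIntegrable _ _)
  have hint : (∫ q in (0 : ℝ)..1,
      ∑ y, c y * ((∏ i, bernoulliWeight q (b y i)) * ∑ i, (boolBit (b y i) - q))) =
      ∫ q in (0 : ℝ)..1, q * (1 - q) * G' q := by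
    refine intervalIntegral.integral_congr fun q _ => ?_
    simp only [hG', Finset.mul_sum (a := q * (1 - q))]
    refine Finset.sum_congr rfl fun y _ => ?_
    rw [← mul_bernoulliProdDeriv]
    ring
  rw [hint, hparts]
  -- The error term carries `|q - 1 / 2|`, replaced by the quadratic majorant `7 / 4 * x ^ 2 + 1 / 7
  -- ≥ |x|` so that the bound is the integral of a polynomial. The constants are tight enough to
  -- leave `1 / 100`.
  have hlow : ∫ q in (0 : ℝ)..1, (4 / 3 * (q - 1 / 2) ^ 2 -
      2 * (13 / 75) * (7 / 4 * (q - 1 / 2) ^ 2 + 1 / 7)) ≤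
      ∫ q in (0 : ℝ)..1, -((1 - 2 * q) * G q) := by
    refine intervalIntegral.integral_mono_on zero_le_one
      (Continuous.intervalIntegrable (by fun_prop) _ _)
      (Continuous.intervalIntegrable (by fun_prop) _ _) fun q hq => ?_
    have h1 := h q hq
    have h2 : |(q - 1 / 2) * (G q - 2 / 3 * (q - 1 / 2))| ≤
        (7 / 4 * (q - 1 / 2) ^ 2 + 1 / 7) * (13 / 75) := by
      rw [abs_mul]
      refine mul_le_mul ?_ h1 (abs_nonneg _) (by positivity)
      nlinarith [sq_nonneg (7 / 2 * |q - 1 / 2| - 1), sq_abs (q - 1 / 2)]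
    have h3 := (abs_le.1 h2).1
    nlinarith
  have hval : ∫ q in (0 : ℝ)..1, (4 / 3 * (q - 1 / 2) ^ 2 -
      2 * (13 / 75) * (7 / 4 * (q - 1 / 2) ^ 2 + 1 / 7)) ≥ 1 / 100 := by
    have : (fun q : ℝ => (4 / 3 * (q - 1 / 2) ^ 2 -
      2 * (13 / 75) * (7 / 4 * (q - 1 / 2) ^ 2 + 1 / 7))) =
      fun q => (4 / 3 - 91 / 150) * q ^ 2 - (4 / 3 - 91 / 150) * q
        + ((4 / 3 - 91 / 150) / 4 - 26 / 525) := by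
      funext q; ring
    rw [this, intervalIntegral.integral_add, intervalIntegral.integral_sub,
      intervalIntegral.integral_const_mul, intervalIntegral.integral_const_mul]
    · simp
      norm_num
    all_goals exact Continuous.intervalIntegrable (by fun_prop) _ _
  rw [intervalIntegral.integral_neg] at hlow
  linarith

end Fingerprinting

/-! ### Resampling one coordinate of a product measure -/

section UpdateIntegral

theorem measurePreserving_update_pi {ι Ω : Type*} [Fintype ι] [DecidableEq ι] [MeasurableSpace Ω]
    (μ : Measure Ω) [IsProbabilityMeasure μ] (j : ι) :
    MeasurePreserving (fun p : (ι → Ω) × Ω => Function.update p.1 j p.2)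
      ((Measure.pi fun _ => μ).prod μ) (Measure.pi fun _ => μ) := by
  have hm : Measurable (fun p : (ι → Ω) × Ω => Function.update p.1 j p.2) := by
    rw [measurable_pi_iff]
    intro k
    by_cases hk : k = j
    · subst hk
      simpa using measurable_snd
    · simp only [Function.update_of_ne hk]
      exact (measurable_pi_apply k).comp measurable_fst
  refine ⟨hm, (Measure.pi_eq fun s hs => ?_).symm⟩
  rw [Measure.map_apply hm (MeasurableSet.univ_pi hs)]
  have hpre : (fun p : (ι → Ω) × Ω => Function.update p.1 j p.2) ⁻¹' Set.univ.pi s =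
      (Set.univ.pi (Function.update s j Set.univ)) ×ˢ s j := by
    ext ⟨p, q⟩
    simp only [Set.mem_preimage, Set.mem_pi, Set.mem_univ, true_imp_iff, Set.mem_prod]
    constructor
    · intro h
      refine ⟨fun k => ?_, by simpa using h j⟩
      by_cases hk : k = j
      · subst hk; simp
      · simpa [hk] using h k
    · rintro ⟨h1, h2⟩ k
      by_cases hk : k = j
      · subst hk; simpa using h2
      · simpa [hk] using h1 k
  rw [hpre, Measure.prod_prod, Measure.pi_pi,
    ← Finset.mul_prod_erase Finset.univ _ (Finset.mem_univ j),
    ← Finset.mul_prod_erase Finset.univ (fun i => μ (s i)) (Finset.mem_univ j)]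
  simp only [Function.update_self, measure_univ, one_mul]
  rw [mul_comm]
  congr 1
  refine Finset.prod_congr rfl fun k hk => ?_
  rw [Function.update_of_ne (Finset.ne_of_mem_erase hk)]

theorem integral_pi_update {ι Ω : Type*} [Fintype ι] [DecidableEq ι] [MeasurableSpace Ω]
    (μ : Measure Ω) [IsProbabilityMeasure μ] (j : ι) {F : (ι → Ω) → ℝ}
    (hF : Integrable F (Measure.pi fun _ => μ)) :
    ∫ p, F p ∂(Measure.pi fun _ => μ) =
      ∫ p, ∫ q, F (Function.update p j q) ∂μ ∂(Measure.pi fun _ => μ) := by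
  have hmp := measurePreserving_update_pi μ j
  have h1 : ∫ p, F p ∂(Measure.pi fun _ => μ) =
      ∫ p : (ι → Ω) × Ω, F (Function.update p.1 j p.2) ∂((Measure.pi fun _ => μ).prod μ) := by
    conv_lhs => rw [← hmp.map_eq]
    refine integral_map hmp.measurable.aemeasurable ?_
    rw [hmp.map_eq]
    exact hF.aestronglyMeasurable
  rw [h1]
  exact integral_prod _ (hmp.integrable_comp_of_integrable hF)

end UpdateIntegral

/-! ### From privacy of events to expectations of bounded functions -/

section Privacy

variable {Ω : Type*} [MeasurableSpace Ω] {μ ν : Measure Ω} [IsProbabilityMeasure μ]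
  [IsProbabilityMeasure ν] {E δ : ℝ}

theorem integrable_of_measurable_of_abs_le (μ : Measure Ω) [IsProbabilityMeasure μ]
    {Z : Ω → ℝ} (hZ : Measurable Z) {B : ℝ}
    (hB : ∀ ω, |Z ω| ≤ B) : Integrable Z μ :=
  Integrable.of_bound hZ.aestronglyMeasurable B (Filter.Eventually.of_forall hB)

/-- Layer cake: integrate the inequality for the superlevel sets over levels in `[0, B]`. -/
theorem integral_le_of_real_le (hδ : ∀ U, MeasurableSet U → μ.real U ≤ E * ν.real U + δ)
    {Z : Ω → ℝ} (hZ : Measurable Z) {B : ℝ} (h0 : ∀ ω, 0 ≤ Z ω) (hB : ∀ ω, Z ω ≤ B) (hB0 : 0 ≤ B) :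
    ∫ ω, Z ω ∂μ ≤ E * ∫ ω, Z ω ∂ν + δ * B := by
  have hb : ∀ ω, |Z ω| ≤ B := fun ω => by rw [abs_of_nonneg (h0 ω)]; exact hB ω
  have hanti : ∀ (ρ : Measure Ω) [IsProbabilityMeasure ρ],
      IntegrableOn (fun t => ρ.real {a | t ≤ Z a}) (Set.Ioc 0 B) := by
    intro ρ _
    have : AntitoneOn (fun t => ρ.real {a | t ≤ Z a}) (Set.Icc 0 B) := by
      intro s _ t _ hst
      exact measureReal_mono fun a ha => le_trans hst ha
    exact (this.integrableOn_isCompact isCompact_Icc).mono_set Set.Ioc_subset_Icc_self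
  rw [(integrable_of_measurable_of_abs_le μ hZ hb).integral_eq_integral_Ioc_meas_le
      (Filter.Eventually.of_forall h0) (Filter.Eventually.of_forall hB),
    (integrable_of_measurable_of_abs_le ν hZ hb).integral_eq_integral_Ioc_meas_le
      (Filter.Eventually.of_forall h0) (Filter.Eventually.of_forall hB)]
  calc ∫ t in Set.Ioc 0 B, μ.real {a | t ≤ Z a}
      ≤ ∫ t in Set.Ioc 0 B, (E * ν.real {a | t ≤ Z a} + δ) := by
        refine setIntegral_mono (hanti μ) (((hanti ν).const_mul E).add (by simp)) fun t => ?_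
        exact hδ _ (measurableSet_le measurable_const hZ)
    _ = _ := by
        rw [integral_add ((hanti ν).const_mul E) (by simp), integral_const_mul]
        simp [hB0, mul_comm]

/-- The positive part of `Z` is bounded by the first inequality and the negative part by the reverse
one. Keeping the loss in the form `(E - 1) * ∫ |Z|` is what later yields `√d` rather than `d`. -/
theorem integral_le_of_real_le_of_abs_le (hE : 1 ≤ E) (hδ0 : 0 ≤ δ)
    (h1 : ∀ U, MeasurableSet U → μ.real U ≤ E * ν.real U + δ)
    (h2 : ∀ U, MeasurableSet U → ν.real U ≤ E * μ.real U + δ)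
    {Z : Ω → ℝ} (hZ : Measurable Z) {B : ℝ} (hB : ∀ ω, |Z ω| ≤ B) (hB0 : 0 ≤ B) :
    ∫ ω, Z ω ∂μ ≤ ∫ ω, Z ω ∂ν + (E - 1) * ∫ ω, |Z ω| ∂ν + 2 * δ * B := by
  set P : Ω → ℝ := fun ω => max (Z ω) 0
  set Q : Ω → ℝ := fun ω => max (-Z ω) 0
  have hP : Measurable P := hZ.max measurable_const
  have hQ : Measurable Q := hZ.neg.max measurable_const
  have hPB : ∀ ω, P ω ≤ B := fun ω => max_le ((le_abs_self _).trans (hB ω)) hB0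
  have hQB : ∀ ω, Q ω ≤ B := fun ω => max_le ((neg_le_abs _).trans (hB ω)) hB0
  have hP0 : ∀ ω, 0 ≤ P ω := fun ω => le_max_right _ _
  have hQ0 : ∀ ω, 0 ≤ Q ω := fun ω => le_max_right _ _
  have hPi : ∀ (ρ : Measure Ω) [IsProbabilityMeasure ρ], Integrable P ρ := fun ρ _ =>
    integrable_of_measurable_of_abs_le ρ hP (B := B) fun ω => by
      rw [abs_of_nonneg (hP0 ω)]; exact hPB ω
  have hQi : ∀ (ρ : Measure Ω) [IsProbabilityMeasure ρ], Integrable Q ρ := fun ρ _ =>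
    integrable_of_measurable_of_abs_le ρ hQ (B := B) fun ω => by
      rw [abs_of_nonneg (hQ0 ω)]; exact hQB ω
  have hZe : Z = fun ω => P ω - Q ω := by
    funext ω
    simp only [P, Q]
    rcases le_total (Z ω) 0 with h | h
    · rw [max_eq_right h, max_eq_left (by linarith)]; ring
    · rw [max_eq_left h, max_eq_right (by linarith)]; ring
  have hAe : (fun ω => |Z ω|) = fun ω => P ω + Q ω := by
    funext ω
    simp only [P, Q]
    rcases le_total (Z ω) 0 with h | h
    · rw [max_eq_right h, max_eq_left (by linarith), abs_of_nonpos h]; ring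
    · rw [max_eq_left h, max_eq_right (by linarith), abs_of_nonneg h]; ring
  rw [hAe, hZe]
  rw [integral_sub (hPi μ) (hQi μ), integral_sub (hPi ν) (hQi ν), integral_add (hPi ν) (hQi ν)]
  have e1 := integral_le_of_real_le h1 hP hP0 hPB hB0
  have e2 := integral_le_of_real_le h2 hQ hQ0 hQB hB0
  have n1 : 0 ≤ ∫ ω, Q ω ∂ν := integral_nonneg hQ0
  have n2 : 0 ≤ ∫ ω, Q ω ∂μ := integral_nonneg hQ0
  have hδB : 0 ≤ δ * B := mul_nonneg hδ0 hB0
  -- For `E ≤ 2`, multiply `e2` by `2 - E` and use `(2 - E) * E = 1 - (E - 1) ^ 2 ≤ 1`; for `E ≥ 2`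
  -- the left side is nonpositive.
  have e3 : (∫ ω, Q ω ∂ν) - (E - 1) * ∫ ω, Q ω ∂ν - δ * B ≤ ∫ ω, Q ω ∂μ := by
    rcases le_total E 2 with h | h
    · have e4 := mul_le_mul_of_nonneg_left e2 (sub_nonneg.2 h)
      have e5 := mul_nonneg (sq_nonneg (E - 1)) n2
      have e6 := mul_nonneg (sub_nonneg.2 hE) hδB
      nlinarith
    · have e4 := mul_nonneg (sub_nonneg.2 h) n1
      nlinarith
  nlinarith

end Privacy

/-! ### Lower bounds for private marginals -/

/-- The centred and truncated answers. -/
noncomputable def centredAnswer {Ω : Type*} {d : ℕ} (n : ℕ) (Q : Ω → Fin d → ℝ) (ω : Ω) (j : Fin d) : ℝ :=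
  max 0 (min 1 (Q ω j / n)) - 1 / 2

theorem abs_centredAnswer_le {Ω : Type*} {n d : ℕ} (Q : Ω → Fin d → ℝ) (ω : Ω) (j : Fin d) :
    |centredAnswer n Q ω j| ≤ 1 / 2 := by
  have h1 : 0 ≤ max 0 (min 1 (Q ω j / n)) := le_max_left _ _
  have h2 : max 0 (min 1 (Q ω j / n)) ≤ 1 := max_le zero_le_one (min_le_left _ _)
  rw [centredAnswer, abs_le]
  constructor <;> linarith

section Marginals

variable {Ω : Type*} [MeasurableSpace Ω] {n d : ℕ}

/-- A private and accurate mechanism for the `d` column sums of a binary data set with `n` records: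
replacing one record changes the law by at most the factor `E` and the summand `δ`, and with
probability at least `2/3` all column sums are answered up to an additive error `α`. -/
structure IsPrivateMarginals (M : (Fin n → Fin d → Bool) → Measure Ω) (Q : Ω → Fin d → ℝ)
    (E δ α : ℝ) : Prop where
  prob : ∀ y, IsProbabilityMeasure (M y)
  dp : ∀ y i v U, MeasurableSet U →
    (M y).real U ≤ E * (M (Function.update y i v)).real U + δ
  measurable : ∀ j, Measurable fun ω => Q ω j
  accurate : ∀ y, (M y).real {ω | ∃ j, α < |Q ω j - ∑ i, boolBit (y i j)|} ≤ 1 / 3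

theorem IsPrivateMarginals.measurableSet_inaccurate {M : (Fin n → Fin d → Bool) → Measure Ω}
    {Q : Ω → Fin d → ℝ} {E δ α : ℝ} (h : IsPrivateMarginals M Q E δ α) (y : Fin n → Fin d → Bool) :
    MeasurableSet {ω | ∃ j, α < |Q ω j - ∑ i, boolBit (y i j)|} := by
  rw [Set.ofPred_exists]
  exact MeasurableSet.iUnion fun j =>
    measurableSet_lt measurable_const (((h.measurable j).sub_const _).abs)

/-- The exceptional set contributes at most `1 / 3 * (1 / 2)`. If `a > 1 / 2`, the global bound `1 /
2` already suffices. -/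
theorem integral_le_of_le_off_small {μ : Measure Ω} [IsProbabilityMeasure μ] {F : Ω → ℝ}
    (hF : Integrable F μ) {B : Set Ω} (hBm : MeasurableSet B) (hB : μ.real B ≤ 1 / 3) {a : ℝ}
    (h1 : ∀ ω, F ω ≤ 1 / 2) (h2 : ∀ ω, ω ∉ B → F ω ≤ a) :
    ∫ ω, F ω ∂μ ≤ 2 / 3 * a + 1 / 6 := by
  rcases le_total a (1 / 2) with ha | ha
  · have hi : Integrable (fun ω => a + B.indicator (fun _ => 1 / 2 - a) ω) μ :=
      (integrable_const a).add ((integrable_const _).indicator hBm)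
    calc ∫ ω, F ω ∂μ ≤ ∫ ω, (a + B.indicator (fun _ => 1 / 2 - a) ω) ∂μ := by
          refine integral_mono hF hi fun ω => ?_
          by_cases hω : ω ∈ B
          · simpa [hω] using h1 ω
          · simpa [hω] using h2 ω hω
      _ = a + μ.real B * (1 / 2 - a) := by
          rw [integral_add (integrable_const a) ((integrable_const _).indicator hBm),
            integral_indicator_const _ hBm]
          simp
      _ ≤ _ := by nlinarith
  · calc ∫ ω, F ω ∂μ ≤ ∫ _, (1 / 2 : ℝ) ∂μ := integral_mono hF (integrable_const _) h1
      _ ≤ _ := by simp; linarith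

theorem boolBit_nonneg (b : Bool) : 0 ≤ boolBit b := by cases b <;> simp [boolBit]

theorem boolBit_le_one (b : Bool) : boolBit b ≤ 1 := by cases b <;> simp [boolBit]

theorem abs_truncate_sub_le {x m e : ℝ} (h0 : 0 ≤ m) (h1 : m ≤ 1) (h : |x - m| ≤ e) :
    |max 0 (min 1 x) - m| ≤ e := by
  rw [abs_le] at h ⊢
  rcases max_cases 0 (min 1 x) with ⟨h2, h3⟩ | ⟨h2, h3⟩ <;>
  rcases min_cases 1 x with ⟨h4, h5⟩ | ⟨h4, h5⟩ <;> constructor <;> linarith [h.1, h.2]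

namespace IsPrivateMarginals

variable {M : (Fin n → Fin d → Bool) → Measure Ω} {Q : Ω → Fin d → ℝ} {E δ α : ℝ}

theorem measurable_centredAnswer (h : IsPrivateMarginals M Q E δ α) (j : Fin d) :
    Measurable fun ω => centredAnswer n Q ω j :=
  (measurable_const.max (measurable_const.min ((h.measurable j).div_const _))).sub_const _

theorem integrable_centredAnswer (h : IsPrivateMarginals M Q E δ α) (y : Fin n → Fin d → Bool)
    (j : Fin d) : Integrable (fun ω => centredAnswer n Q ω j) (M y) :=
  have := h.prob y
  integrable_of_measurable_of_abs_le _ (h.measurable_centredAnswer j) (abs_centredAnswer_le Q · j)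

/-- Accuracy holds only with probability `2 / 3`, hence the slope `2 / 3`; the error is `2 / 3 * (1
/ 100) + 1 / 6 = 13 / 75`. -/
theorem abs_integral_centredAnswer_sub_le (h : IsPrivateMarginals M Q E δ α) (hn : 0 < n)
    (hα : α ≤ n / 100) (y : Fin n → Fin d → Bool) (j : Fin d) :
    |∫ ω, centredAnswer n Q ω j ∂(M y) - 2 / 3 * ((∑ i, boolBit (y i j)) / n - 1 / 2)| ≤
      13 / 75 := by
  have := h.prob y
  have hn' : (0 : ℝ) < n := by exact_mod_cast hn
  set m : ℝ := (∑ i, boolBit (y i j)) / n with hm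
  have hm0 : 0 ≤ m := div_nonneg (Finset.sum_nonneg fun _ _ => boolBit_nonneg _) hn'.le
  have hm1 : m ≤ 1 := by
    rw [hm, div_le_one hn']
    calc ∑ i, boolBit (y i j) ≤ ∑ _i : Fin n, (1 : ℝ) :=
          Finset.sum_le_sum fun _ _ => boolBit_le_one _
      _ = n := by simp
  have hgood : ∀ ω, ω ∉ {ω | ∃ j, α < |Q ω j - ∑ i, boolBit (y i j)|} →
      |max 0 (min 1 (Q ω j / n)) - m| ≤ 1 / 100 := by
    intro ω hω
    simp only [Set.mem_ofPred_eq, not_exists, not_lt] at hω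
    refine abs_truncate_sub_le hm0 hm1 ?_
    rw [hm, ← sub_div, abs_div, abs_of_pos hn', div_le_iff₀ hn']
    linarith [hω j]
  have hi := h.integrable_centredAnswer y j
  have up := integral_le_of_le_off_small hi (h.measurableSet_inaccurate y) (h.accurate y)
    (a := m - 1 / 2 + 1 / 100) (fun ω => (le_abs_self _).trans (abs_centredAnswer_le Q ω j))
    fun ω hω => by
      have := (abs_le.1 (hgood ω hω)).2
      rw [centredAnswer]; linarith
  have low := integral_le_of_le_off_small hi.neg (h.measurableSet_inaccurate y) (h.accurate y)
    (a := -(m - 1 / 2) + 1 / 100) (fun ω => (neg_le_abs _).trans (abs_centredAnswer_le Q ω j))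
    fun ω hω => by
      have := (abs_le.1 (hgood ω hω)).1
      simp only [Pi.neg_apply, centredAnswer]; linarith
  simp only [Pi.neg_apply] at low
  rw [integral_neg] at low
  rw [abs_le]
  constructor <;> linarith

/-- The expected correlation of the answers with the data set, for data with attribute means `u`. -/
noncomputable def fingerprint (M : (Fin n → Fin d → Bool) → Measure Ω) (Q : Ω → Fin d → ℝ)
    (u : Fin d → ℝ) (j : Fin d) : ℝ :=
  ∑ y : Fin n → Fin d → Bool, (∏ i, recordWeight u (y i)) *
    ((∫ ω, centredAnswer n Q ω j ∂(M y)) * ∑ i, (boolBit (y i j) - u j))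

/-- The total correlation splits into one term per record. By privacy the answers may be computed
with record `i` resampled; then they are independent of the original record, so the mean vanishes
and only the privacy losses remain. -/
theorem sum_fingerprint_le (h : IsPrivateMarginals M Q E δ α) (hE : 1 ≤ E) (hδ : 0 ≤ δ)
    {u : Fin d → ℝ} (h0 : ∀ j, 0 ≤ u j) (h1 : ∀ j, u j ≤ 1) :
    ∑ j, fingerprint M Q u j ≤ n * ((E - 1) * Real.sqrt d + 2 * d * δ) := by
  have := h.prob
  set Z : Ω → (Fin d → Bool) → ℝ := fun ω v => ∑ j, centredAnswer n Q ω j * (boolBit (v j) - u j)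
    with hZ
  have hZm : ∀ v, Measurable fun ω => Z ω v := fun v =>
    Finset.measurable_fun_sum _ fun j _ => (h.measurable_centredAnswer j).mul_const _
  have hZB : ∀ v ω, |Z ω v| ≤ d := by
    intro v ω
    calc |Z ω v| ≤ ∑ j, |centredAnswer n Q ω j * (boolBit (v j) - u j)| :=
          Finset.abs_sum_le_sum_abs _ _
      _ ≤ ∑ _j : Fin d, (1 : ℝ) := by
          refine Finset.sum_le_sum fun j _ => ?_
          rw [abs_mul]
          have a1 := abs_centredAnswer_le (n := n) Q ω j
          have a2 : |boolBit (v j) - u j| ≤ 1 := by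
            rw [abs_le]
            constructor <;>
              linarith [boolBit_nonneg (v j), boolBit_le_one (v j), h0 j, h1 j]
          nlinarith [abs_nonneg (centredAnswer n Q ω j), abs_nonneg (boolBit (v j) - u j)]
      _ = d := by simp
  have hZi : ∀ y v, Integrable (fun ω => Z ω v) (M y) := fun y v =>
    integrable_of_measurable_of_abs_le _ (hZm v) (hZB v)
  have hw : ∀ y : Fin n → Fin d → Bool, 0 ≤ ∏ i, recordWeight u (y i) := fun y =>
    Finset.prod_nonneg fun i _ => recordWeight_nonneg h0 h1 _
  have hw1 : ∑ y : Fin n → Fin d → Bool, ∏ i, recordWeight u (y i) = 1 :=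
    sum_prod_weight_eq_one (r := fun _ => recordWeight u) fun _ => recordWeight_sum u
  have hre : ∑ j, fingerprint M Q u j =
      ∑ i, ∑ y : Fin n → Fin d → Bool, (∏ i, recordWeight u (y i)) * ∫ ω, Z ω (y i) ∂(M y) := by
    simp only [fingerprint]
    rw [Finset.sum_comm]
    conv_rhs => rw [Finset.sum_comm]
    refine Finset.sum_congr rfl fun y _ => ?_
    rw [← Finset.mul_sum, ← Finset.mul_sum]
    congr 1
    simp only [Finset.mul_sum]
    rw [Finset.sum_comm]
    refine Finset.sum_congr rfl fun i _ => ?_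
    rw [integral_finsetSum _ fun j _ => (h.integrable_centredAnswer y j).mul_const _]
    refine Finset.sum_congr rfl fun j _ => ?_
    rw [integral_mul_const]
  have hrec : ∀ i : Fin n, ∑ y : Fin n → Fin d → Bool,
      (∏ i, recordWeight u (y i)) * ∫ ω, Z ω (y i) ∂(M y) ≤
      (E - 1) * Real.sqrt d + 2 * d * δ := by
    intro i
    -- An independent copy `v` of record `i` is introduced. After privacy moves the mechanism to the
    -- data set with `v` in place of `y i`, the swap `s2` exchanges their roles.
    have s1 : ∑ y : Fin n → Fin d → Bool, (∏ i, recordWeight u (y i)) * ∫ ω, Z ω (y i) ∂(M y) =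
        ∑ y : Fin n → Fin d → Bool, ∑ v, (∏ i, recordWeight u (y i)) * recordWeight u v *
          ∫ ω, Z ω (y i) ∂(M y) := by
      refine Finset.sum_congr rfl fun y _ => ?_
      rw [← Finset.sum_mul, ← Finset.mul_sum, recordWeight_sum, mul_one]
    have s2 := sum_prod_weight_swap (fun _ : Fin n => recordWeight u) i fun y v =>
      (∫ ω, Z ω v ∂(M y)) + (E - 1) * (∫ ω, |Z ω v| ∂(M y)) + 2 * δ * d
    have s3 : ∀ y : Fin n → Fin d → Bool, ∑ v, (∏ i, recordWeight u (y i)) * recordWeight u v *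
        ((∫ ω, Z ω v ∂(M y)) + (E - 1) * (∫ ω, |Z ω v| ∂(M y)) + 2 * δ * d) ≤
        (∏ i, recordWeight u (y i)) * ((E - 1) * Real.sqrt d + 2 * d * δ) := by
      intro y
      have t1 : ∑ v, recordWeight u v * ∫ ω, Z ω v ∂(M y) = 0 := by
        simp only [← integral_const_mul]
        rw [← integral_finsetSum _ fun v _ => (hZi y v).const_mul _]
        simp [hZ, sum_recordWeight_linear]
      have t2 : ∑ v, recordWeight u v * ∫ ω, |Z ω v| ∂(M y) ≤ Real.sqrt d := by
        simp only [← integral_const_mul]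
        rw [← integral_finsetSum _ fun v _ => (hZi y v).abs.const_mul _]
        calc ∫ ω, ∑ v, recordWeight u v * |Z ω v| ∂(M y) ≤ ∫ _, Real.sqrt d ∂(M y) := by
              refine integral_mono
                (integrable_finsetSum _ fun v _ => (hZi y v).abs.const_mul _)
                (integrable_const _) fun ω => ?_
              exact sum_recordWeight_abs_le h0 h1
                fun j => (abs_centredAnswer_le Q ω j).trans (by norm_num)
          _ = _ := by simp
      have t3 : ∑ v, (∏ i, recordWeight u (y i)) * recordWeight u v *
          ((∫ ω, Z ω v ∂(M y)) + (E - 1) * (∫ ω, |Z ω v| ∂(M y)) + 2 * δ * d) =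
          (∏ i, recordWeight u (y i)) * (∑ v, recordWeight u v * ∫ ω, Z ω v ∂(M y) +
            (E - 1) * ∑ v, recordWeight u v * ∫ ω, |Z ω v| ∂(M y) +
            (∑ v, recordWeight u v) * (2 * δ * d)) := by
        rw [Finset.mul_sum, Finset.sum_mul, ← Finset.sum_add_distrib, ← Finset.sum_add_distrib,
          Finset.mul_sum]
        refine Finset.sum_congr rfl fun v _ => ?_
        ring
      rw [t3, t1, recordWeight_sum]
      refine mul_le_mul_of_nonneg_left ?_ (hw y)
      have := mul_le_mul_of_nonneg_left t2 (sub_nonneg.2 hE)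
      linarith
    rw [s1]
    calc ∑ y : Fin n → Fin d → Bool, ∑ v, (∏ i, recordWeight u (y i)) * recordWeight u v *
          ∫ ω, Z ω (y i) ∂(M y)
        ≤ ∑ y : Fin n → Fin d → Bool, ∑ v, (∏ i, recordWeight u (y i)) * recordWeight u v *
          ((∫ ω, Z ω (y i) ∂(M (Function.update y i v))) +
            (E - 1) * (∫ ω, |Z ω (y i)| ∂(M (Function.update y i v))) + 2 * δ * d) := by
          refine Finset.sum_le_sum fun y _ => Finset.sum_le_sum fun v _ =>
            mul_le_mul_of_nonneg_left ?_ (mul_nonneg (hw y) (recordWeight_nonneg h0 h1 v))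
          refine integral_le_of_real_le_of_abs_le hE hδ (h.dp y i v) (fun U hU => ?_) (hZm _)
            (hZB _) (Nat.cast_nonneg d)
          simpa using h.dp (Function.update y i v) i (y i) U hU
      _ = _ := s2.symm
      _ ≤ ∑ y : Fin n → Fin d → Bool, (∏ i, recordWeight u (y i)) *
          ((E - 1) * Real.sqrt d + 2 * d * δ) := Finset.sum_le_sum fun y _ => s3 y
      _ = _ := by rw [← Finset.sum_mul, hw1, one_mul]
  rw [hre]
  calc _ ≤ ∑ _i : Fin n, ((E - 1) * Real.sqrt d + 2 * d * δ) :=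
        Finset.sum_le_sum fun i _ => hrec i
    _ = _ := by rw [Finset.sum_const, nsmul_eq_mul, Finset.card_univ, Fintype.card_fin]

theorem sum_dataWeight_column (u : Fin d → ℝ) (hn : 0 < n) (j : Fin d) :
    ∑ y : Fin n → Fin d → Bool, (∏ i, recordWeight u (y i)) * ((∑ i, boolBit (y i j)) / n) =
      u j := by
  have h1 : ∀ i : Fin n, ∑ y : Fin n → Fin d → Bool, (∏ i, recordWeight u (y i)) *
      boolBit (y i j) = u j := by
    intro i
    rw [sum_prod_weight_resample (r := fun _ => recordWeight u) i (recordWeight_sum u)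
      (fun y => boolBit (y i j))]
    simp only [Function.update_self]
    rw [← Finset.sum_mul, sum_prod_weight_eq_one fun _ => recordWeight_sum u, one_mul,
      sum_recordWeight_coord]
    simp [bernoulliWeight, boolBit]
  have hn' : (n : ℝ) ≠ 0 := by exact_mod_cast hn.ne'
  simp only [Finset.sum_div, Finset.mul_sum]
  rw [Finset.sum_comm]
  simp only [mul_div_assoc', ← Finset.sum_div]
  rw [Finset.sum_congr rfl fun i _ => h1 i]
  simp [hn']

theorem prod_recordWeight_update (u : Fin d → ℝ) (j : Fin d) (q : ℝ) (y : Fin n → Fin d → Bool) :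
    ∏ i, recordWeight (Function.update u j q) (y i) =
      (∏ i, ∏ k ∈ Finset.univ.erase j, bernoulliWeight (u k) (y i k)) *
        ∏ i, bernoulliWeight q (y i j) := by
  rw [← Finset.prod_mul_distrib]
  refine Finset.prod_congr rfl fun i _ => ?_
  rw [recordWeight, ← Finset.mul_prod_erase Finset.univ _ (Finset.mem_univ j), mul_comm]
  congr 1
  · refine Finset.prod_congr rfl fun k hk => ?_
    rw [Function.update_of_ne (Finset.ne_of_mem_erase hk)]
  · simp

/-- With the other means frozen, the weights of the other columns and the expected answer form the
coefficients `c y` of `fingerprinting_column`. Its hypothesis holds because the column average has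
expectation `q`. -/
theorem le_integral_fingerprint_update (h : IsPrivateMarginals M Q E δ α) (hn : 0 < n)
    (hα : α ≤ n / 100) {u : Fin d → ℝ} (h0 : ∀ j, 0 ≤ u j) (h1 : ∀ j, u j ≤ 1) (j : Fin d) :
    1 / 100 ≤ ∫ q in (0 : ℝ)..1, fingerprint M Q (Function.update u j q) j := by
  have key := fingerprinting_column
    (fun y : Fin n → Fin d → Bool => (∏ i, ∏ k ∈ Finset.univ.erase j, bernoulliWeight (u k) (y i k))
      * ∫ ω, centredAnswer n Q ω j ∂(M y)) (fun y i => y i j) ?_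
  · refine key.trans_eq (intervalIntegral.integral_congr fun q _ => ?_)
    simp only [fingerprint, Function.update_self]
    refine Finset.sum_congr rfl fun y _ => ?_
    rw [prod_recordWeight_update]
    ring
  · rintro q ⟨hq0, hq1⟩
    set u' := Function.update u j q with hu'
    have h0' : ∀ k, 0 ≤ u' k := by
      intro k
      by_cases hk : k = j
      · subst hk; simpa [hu'] using hq0
      · simpa [hu', hk] using h0 k
    have h1' : ∀ k, u' k ≤ 1 := by
      intro k
      by_cases hk : k = j
      · subst hk; simpa [hu'] using hq1
      · simpa [hu', hk] using h1 k
    have hw : ∀ y : Fin n → Fin d → Bool, 0 ≤ ∏ i, recordWeight u' (y i) := fun y =>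
      Finset.prod_nonneg fun i _ => recordWeight_nonneg h0' h1' _
    have hw1 : ∑ y : Fin n → Fin d → Bool, ∏ i, recordWeight u' (y i) = 1 :=
      sum_prod_weight_eq_one (r := fun _ => recordWeight u') fun _ => recordWeight_sum u'
    have hcol := sum_dataWeight_column u' hn j
    have hq : u' j = q := by simp [hu']
    rw [hq] at hcol
    have e : (∑ y : Fin n → Fin d → Bool,
        ((∏ i, ∏ k ∈ Finset.univ.erase j, bernoulliWeight (u k) (y i k))
          * ∫ ω, centredAnswer n Q ω j ∂(M y)) * ∏ i, bernoulliWeight q (y i j)) -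
        2 / 3 * (q - 1 / 2) =
        ∑ y : Fin n → Fin d → Bool, (∏ i, recordWeight u' (y i)) *
          (∫ ω, centredAnswer n Q ω j ∂(M y) -
            2 / 3 * ((∑ i, boolBit (y i j)) / n - 1 / 2)) := by
      have e1 : ∀ y : Fin n → Fin d → Bool, (∏ i, recordWeight u' (y i)) *
          (∫ ω, centredAnswer n Q ω j ∂(M y) -
            2 / 3 * ((∑ i, boolBit (y i j)) / n - 1 / 2)) =
          ((∏ i, ∏ k ∈ Finset.univ.erase j, bernoulliWeight (u k) (y i k))
          * ∫ ω, centredAnswer n Q ω j ∂(M y)) * (∏ i, bernoulliWeight q (y i j)) -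
          (2 / 3 * ((∏ i, recordWeight u' (y i)) * ((∑ i, boolBit (y i j)) / n)) -
            1 / 3 * (∏ i, recordWeight u' (y i))) := by
        intro y
        rw [hu', prod_recordWeight_update]
        ring
      simp only [e1]
      rw [Finset.sum_sub_distrib, Finset.sum_sub_distrib, ← Finset.mul_sum, hcol,
        ← Finset.mul_sum, hw1]
      ring
    rw [e]
    calc _ ≤ ∑ y : Fin n → Fin d → Bool, |(∏ i, recordWeight u' (y i)) *
          (∫ ω, centredAnswer n Q ω j ∂(M y) -
            2 / 3 * ((∑ i, boolBit (y i j)) / n - 1 / 2))| := Finset.abs_sum_le_sum_abs _ _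
      _ ≤ ∑ y : Fin n → Fin d → Bool, (∏ i, recordWeight u' (y i)) * (13 / 75) := by
          refine Finset.sum_le_sum fun y _ => ?_
          rw [abs_mul, abs_of_nonneg (hw y)]
          exact mul_le_mul_of_nonneg_left (h.abs_integral_centredAnswer_sub_le hn hα y j) (hw y)
      _ = _ := by rw [← Finset.sum_mul, hw1, one_mul]

theorem continuous_fingerprint (j : Fin d) : Continuous fun u => fingerprint M Q u j := by
  refine continuous_finsetSum _ fun y _ => Continuous.mul ?_ (by fun_prop)
  refine continuous_finsetProd _ fun i _ => continuous_finsetProd _ fun k _ => ?_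
  exact (continuous_bernoulliWeight _).comp (continuous_apply k)

/-- Average over uniform means: each column contributes at least `1 / 100`, by integrating its own
mean first, while the upper bound on the sum holds for every choice of means. -/
theorem le_of_accurate (h : IsPrivateMarginals M Q E δ α) (hE : 1 ≤ E) (hδ : 0 ≤ δ) (hn : 0 < n)
    (hα : α ≤ n / 100) : (d : ℝ) / 100 ≤ n * ((E - 1) * Real.sqrt d + 2 * d * δ) := by
  let π : Measure (Fin d → unitInterval) := Measure.pi fun _ => volume
  let Φ : Fin d → (Fin d → unitInterval) → ℝ := fun j u =>
    fingerprint M Q (fun k => (u k : ℝ)) j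
  have hΦc : ∀ j, Continuous (Φ j) := fun j =>
    (continuous_fingerprint j).comp (by fun_prop)
  have hΦi : ∀ j, Integrable (Φ j) π := fun j =>
    (hΦc j).integrable_of_hasCompactSupport (HasCompactSupport.of_compactSpace _)
  have hlow : ∀ j, 1 / 100 ≤ ∫ u, Φ j u ∂π := by
    intro j
    rw [integral_pi_update volume j (hΦi j)]
    have hin : ∀ u : Fin d → unitInterval, 1 / 100 ≤
        ∫ q : unitInterval, Φ j (Function.update u j q) := by
      intro u
      have hk := h.le_integral_fingerprint_update hn hα (u := fun k => (u k : ℝ))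
        (fun k => (u k).2.1) (fun k => (u k).2.2) j
      rw [intervalIntegral.integral_of_le zero_le_one, ← integral_Icc_eq_integral_Ioc,
        ← integral_subtype measurableSet_Icc] at hk
      refine hk.trans_eq (integral_congr_ae (Filter.Eventually.of_forall fun q => ?_))
      simp only [Φ]
      congr 1
      funext k
      by_cases hk : k = j
      · subst hk; simp
      · simp [hk]
    have hint : Integrable (fun u => ∫ q : unitInterval, Φ j (Function.update u j q)) π :=
      ((measurePreserving_update_pi volume j).integrable_comp_of_integrable (hΦi j)).integral_prod_left
    calc (1 / 100 : ℝ) = ∫ _, (1 / 100 : ℝ) ∂π := by simp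
      _ ≤ _ := integral_mono (integrable_const _) hint hin
  calc (d : ℝ) / 100 = ∑ _j : Fin d, (1 / 100 : ℝ) := by simp; ring
    _ ≤ ∑ j, ∫ u, Φ j u ∂π := Finset.sum_le_sum fun j _ => hlow j
    _ = ∫ u, ∑ j, Φ j u ∂π := (integral_finsetSum _ fun j _ => hΦi j).symm
    _ ≤ ∫ _, (n * ((E - 1) * Real.sqrt d + 2 * d * δ)) ∂π := by
        refine integral_mono (integrable_finsetSum _ fun j _ => hΦi j) (integrable_const _)
          fun u => ?_
        exact h.sum_fingerprint_le hE hδ (fun k => (u k).2.1) (fun k => (u k).2.2)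
    _ = _ := by simp

/-! ### Group privacy and packing -/

theorem real_le_pow_mul (h : IsPrivateMarginals M Q E 0 α) (hE : 0 ≤ E)
    (y y' : Fin n → Fin d → Bool) {U : Set Ω} (hU : MeasurableSet U) :
    (M y).real U ≤ E ^ n * (M y').real U := by
  have key : ∀ s : Finset (Fin n), (M y).real U ≤ E ^ s.card * (M (s.piecewise y' y)).real U := by
    intro s
    induction s using Finset.induction_on with
    | empty => simp
    | insert i s hi ih =>
      rw [Finset.card_insert_of_notMem hi, Finset.piecewise_insert, pow_succ, mul_assoc]
      refine ih.trans (mul_le_mul_of_nonneg_left ?_ (pow_nonneg hE _))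
      simpa using h.dp (s.piecewise y' y) i (y' i) U hU
  simpa using key Finset.univ

/-- Data sets whose records all equal `v` have column sums `0` or `n`, so for `α < n / 2` the
accurate events of different `v` are disjoint. Each has probability at least `2 / 3`, and by group
privacy at least `2 / 3 * E ^ (-n)` under one common law, where they sum to at most 1. -/
theorem two_pow_le_of_pure (h : IsPrivateMarginals M Q E 0 α) (hE : 0 ≤ E) (hα : α < n / 2) :
    2 / 3 * (2 : ℝ) ^ d ≤ E ^ n := by
  have := h.prob
  let U : (Fin d → Bool) → Set Ω := fun v => {ω | ∃ j, α < |Q ω j - ∑ _i : Fin n, boolBit (v j)|}ᶜ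
  have hUm : ∀ v, MeasurableSet (U v) := fun v => (h.measurableSet_inaccurate fun _ => v).compl
  have hU : ∀ v, 2 / 3 ≤ (M fun _ => v).real (U v) := by
    intro v
    have h1 := h.accurate fun _ => v
    rw [probReal_compl_eq_one_sub (h.measurableSet_inaccurate fun _ => v)]
    linarith
  have hdisj : Pairwise fun v v' => Disjoint (U v) (U v') := by
    intro v v' hv
    obtain ⟨j, hj⟩ := Function.ne_iff.1 hv
    refine Set.disjoint_left.2 fun ω h1 h2 => ?_
    simp only [U, Set.mem_compl_iff, Set.mem_ofPred_eq, not_exists, not_lt] at h1 h2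
    have a1 := abs_le.1 (h1 j)
    have a2 := abs_le.1 (h2 j)
    simp only [Finset.sum_const, Finset.card_univ, Fintype.card_fin, nsmul_eq_mul] at a1 a2
    cases hvj : v j <;> cases hvj' : v' j <;> simp_all [boolBit] <;> linarith [a1.1, a1.2, a2.1]
  calc 2 / 3 * (2 : ℝ) ^ d = ∑ _v : Fin d → Bool, (2 / 3 : ℝ) := by
        simp; ring
    _ ≤ ∑ v, E ^ n * (M fun _ _ => false).real (U v) :=
        Finset.sum_le_sum fun v _ => (hU v).trans (h.real_le_pow_mul hE _ _ (hUm v))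
    _ = E ^ n * (M fun _ _ => false).real (⋃ v ∈ Finset.univ, U v) := by
        rw [← Finset.mul_sum, measureReal_biUnion_finset (fun v _ v' _ hv => hdisj hv)
          fun v _ => hUm v]
    _ ≤ E ^ n := mul_le_of_le_one_right (pow_nonneg hE _) measureReal_le_one

end IsPrivateMarginals

end Marginals

/-! ### Dynamic graph sequences built from gadgets -/

/-- A family of `n` gadgets on the node set `V`: base edges, and for each gadget a probe edge and
two toggle edges. An edge of the form `s(v, v)` stands for no edge. -/
structure Gadget (V : Type*) (n : ℕ) where
  Base : Type
  fintypeBase : Fintype Base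
  base : Base → Sym2 V
  probe : Fin n → Sym2 V
  toggle : Fin n → Bool → Sym2 V

namespace Gadget

variable {V : Type*} {n : ℕ}

instance (g : Gadget V n) : Fintype g.Base := g.fintypeBase

/-- The number of base edges. -/
def size (g : Gadget V n) : ℕ := Fintype.card g.Base

/-- The graph with all base edges, the probe edge of at most one gadget, and for some gadgets one
of the toggle edges. -/
def stateGraph (g : Gadget V n) (o : Option (Fin n)) (w : Fin n → Option Bool) : SimpleGraph V :=
  SimpleGraph.fromEdgeSet {a | (∃ k, a = g.base k) ∨ (∃ i, o = some i ∧ a = g.probe i) ∨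
    ∃ i b, w i = some b ∧ a = g.toggle i b}

/-- Names for the edges of a sequence with `d` phases. -/
abbrev Label (g : Gadget V n) (d : ℕ) := g.Base ⊕ Fin n ⊕ (Fin n × Fin d)

/-- The edge with a given name, for the data set `y`. -/
def labelEdge (g : Gadget V n) {d : ℕ} (y : Fin n → Fin d → Bool) : g.Label d → Sym2 V
  | .inl k => g.base k
  | .inr (.inl i) => g.probe i
  | .inr (.inr (i, j)) => g.toggle i (y i j)

/-- The time step before which the toggle edge of gadget `i` is inserted in phase `j`; it is deleted
`n` steps later. -/
def toggleTime (g : Gadget V n) {d : ℕ} (i : Fin n) (j : Fin d) : ℕ :=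
  g.size + 1 + 2 * n * j + i

/-- The names of the edges which are present at time `t`. -/
noncomputable def active (g : Gadget V n) (d : ℕ) (o : Option (Fin n)) (t : ℕ) : g.Label d → Prop
  | .inl k => (Fintype.equivFin g.Base k : ℕ) < t
  | .inr (.inl i) => o = some i ∧ g.size < t
  | .inr (.inr (i, j)) => g.toggleTime i j < t ∧ t ≤ g.toggleTime i j + n

theorem block_lt (n : ℕ) {j j' : ℕ} (h : j < j') : 2 * n * j + 2 * n ≤ 2 * n * j' := by
  calc 2 * n * j + 2 * n = 2 * n * (j + 1) := by ring
    _ ≤ 2 * n * j' := Nat.mul_le_mul_left _ h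

theorem toggle_phase_unique (g : Gadget V n) {d t : ℕ} {i i' : Fin n} {j j' : Fin d}
    (h1 : g.toggleTime i j ≤ t) (h2 : t ≤ g.toggleTime i j + n)
    (h1' : g.toggleTime i' j' ≤ t) (h2' : t ≤ g.toggleTime i' j' + n) : j = j' := by
  unfold toggleTime at *
  have hi := i.2
  have hi' := i'.2
  rcases lt_trichotomy (j : ℕ) j' with h | h | h
  · have := block_lt n h; omega
  · exact Fin.ext h
  · have := block_lt n h; omega

/-- The schedule assigns each time step to at most one label, so consecutive graphs differ in at
most one edge even where labels name the same edge or no edge. -/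
theorem active_unique (g : Gadget V n) {d : ℕ} {o : Option (Fin n)} {t : ℕ} {l l' : g.Label d}
    (h : ¬(g.active d o t l ↔ g.active d o (t + 1) l))
    (h' : ¬(g.active d o t l' ↔ g.active d o (t + 1) l')) : l = l' := by
  have hbase : ∀ k, ¬(g.active d o t (.inl k) ↔ g.active d o (t + 1) (.inl k)) →
      (Fintype.equivFin g.Base k : ℕ) = t := by
    intro k hk; simp only [active] at hk; omega
  have hprobe : ∀ i, ¬(g.active d o t (.inr (.inl i)) ↔ g.active d o (t + 1) (.inr (.inl i))) →
      o = some i ∧ g.size = t := by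
    intro i hk
    simp only [active] at hk
    by_cases ho : o = some i
    · simp only [ho, true_and] at hk ⊢; omega
    · simp [ho] at hk
  have htoggle : ∀ i j, ¬(g.active d o t (.inr (.inr (i, j))) ↔
      g.active d o (t + 1) (.inr (.inr (i, j)))) →
      g.toggleTime i j = t ∨ g.toggleTime i j + n = t := by
    intro i j hk; simp only [active] at hk; omega
  have hk : ∀ k, (Fintype.equivFin g.Base k : ℕ) < g.size := fun k => (Fintype.equivFin g.Base k).2
  have hT : ∀ i (j : Fin d), g.size < g.toggleTime i j := fun i j => by
    unfold toggleTime; omega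
  rcases l with k | i | ⟨i, j⟩ <;> rcases l' with k' | i' | ⟨i', j'⟩
  · have := (hbase k h).trans (hbase k' h').symm
    rw [(Fintype.equivFin g.Base).injective (Fin.ext this)]
  · have := hbase k h; have := (hprobe i' h').2; have := hk k; omega
  · have := hbase k h; have := htoggle i' j' h'; have := hk k; have := hT i' j'; omega
  · have := hbase k' h'; have := (hprobe i h).2; have := hk k'; omega
  · have := (hprobe i h).1.symm.trans (hprobe i' h').1
    simp_all
  · have := (hprobe i h).2; have := htoggle i' j' h'; have := hT i' j'; omega
  · have := hbase k' h'; have := htoggle i j h; have := hk k'; have := hT i j; omega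
  · have := (hprobe i' h').2; have := htoggle i j h; have := hT i j; omega
  · have a := htoggle i j h
    have a' := htoggle i' j' h'
    have hj : j = j' := g.toggle_phase_unique (t := t) (i := i) (i' := i')
      (by omega) (by omega) (by omega) (by omega)
    subst hj
    have hi := i.2
    have hi' := i'.2
    unfold toggleTime at a a'
    have : i = i' := Fin.ext (by omega)
    rw [this]

/-- The graph at time `t`. -/
noncomputable def seqGraph (g : Gadget V n) {d : ℕ} (o : Option (Fin n)) (y : Fin n → Fin d → Bool)
    (t : ℕ) : SimpleGraph V :=
  SimpleGraph.fromEdgeSet {a | ∃ l, g.active d o t l ∧ a = g.labelEdge y l}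

/-- The sequence that first inserts the base edges and possibly one probe edge and then, in each of
the `d` phases, inserts and deletes one toggle edge of every gadget. -/
noncomputable def seq (g : Gadget V n) {d : ℕ} (T : ℕ) (o : Option (Fin n))
    (y : Fin n → Fin d → Bool) : DynamicGraphSequence V T where
  graph t := g.seqGraph o y t
  graph_zero := by
    rw [seqGraph]
    convert SimpleGraph.fromEdgeSet_empty
    refine Set.eq_empty_iff_forall_notMem.2 ?_
    rintro a ⟨l, hl, -⟩
    rcases l with k | i | ⟨i, j⟩ <;> simp [active] at hl
  step t := by
    rw [Set.encard_le_one_iff]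
    have key : ∀ a, a ∈ symmDiff (g.seqGraph o y t).edgeSet (g.seqGraph o y (t + 1 : ℕ)).edgeSet →
        ∃ l, ¬(g.active d o t l ↔ g.active d o (t + 1) l) ∧ a = g.labelEdge y l := by
      intro a ha
      simp only [seqGraph, SimpleGraph.edgeSet_fromEdgeSet, Set.mem_symmDiff, Set.mem_sdiff,
        Set.mem_ofPred_eq] at ha
      rcases ha with ⟨⟨⟨l, hl, rfl⟩, hd⟩, h2⟩ | ⟨⟨⟨l, hl, rfl⟩, hd⟩, h2⟩
      · exact ⟨l, fun h => h2 ⟨⟨l, h.1 hl, rfl⟩, hd⟩, rfl⟩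
      · exact ⟨l, fun h => h2 ⟨⟨l, h.2 hl, rfl⟩, hd⟩, rfl⟩
    intro a b ha hb
    obtain ⟨l, hl, rfl⟩ := key a (by simpa using ha)
    obtain ⟨l', hl', rfl⟩ := key b (by simpa using hb)
    rw [g.active_unique hl hl']

open scoped Classical in
/-- The toggle edges which are present at time `t`. -/
noncomputable def toggleState (g : Gadget V n) {d : ℕ} (t : ℕ) (y : Fin n → Fin d → Bool)
    (i : Fin n) : Option Bool :=
  if h : ∃ j : Fin d, g.toggleTime i j < t ∧ t ≤ g.toggleTime i j + n then some (y i h.choose)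
  else none

theorem toggleState_eq_some (g : Gadget V n) {d t : ℕ} (y : Fin n → Fin d → Bool) {i : Fin n}
    {j : Fin d} (h : g.toggleTime i j < t ∧ t ≤ g.toggleTime i j + n) :
    g.toggleState t y i = some (y i j) := by
  have hex : ∃ j : Fin d, g.toggleTime i j < t ∧ t ≤ g.toggleTime i j + n := ⟨j, h⟩
  have hs := hex.choose_spec
  rw [toggleState, dif_pos hex, g.toggle_phase_unique hs.1.le hs.2 h.1.le h.2]

theorem toggleState_eq_some_iff (g : Gadget V n) {d t : ℕ} (y : Fin n → Fin d → Bool) {i : Fin n}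
    {b : Bool} : g.toggleState t y i = some b ↔
      ∃ j : Fin d, (g.toggleTime i j < t ∧ t ≤ g.toggleTime i j + n) ∧ y i j = b := by
  constructor
  · intro h
    by_cases hex : ∃ j : Fin d, g.toggleTime i j < t ∧ t ≤ g.toggleTime i j + n
    · obtain ⟨j, hj⟩ := hex
      rw [g.toggleState_eq_some y hj] at h
      exact ⟨j, hj, by simpa using h⟩
    · rw [toggleState, dif_neg hex] at h
      simp at h
  · rintro ⟨j, hj, rfl⟩
    exact g.toggleState_eq_some y hj

theorem seqGraph_eq_stateGraph (g : Gadget V n) {d t : ℕ} (ht : g.size < t) (o : Option (Fin n))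
    (y : Fin n → Fin d → Bool) : g.seqGraph o y t = g.stateGraph o (g.toggleState t y) := by
  rw [seqGraph, stateGraph]
  congr 1
  ext a
  simp only [Set.mem_ofPred_eq, toggleState_eq_some_iff]
  constructor
  · rintro ⟨k | i | ⟨i, j⟩, hl, rfl⟩
    · exact Or.inl ⟨k, rfl⟩
    · exact Or.inr (Or.inl ⟨i, hl.1, rfl⟩)
    · exact Or.inr (Or.inr ⟨i, y i j, ⟨j, hl, rfl⟩, rfl⟩)
  · rintro (⟨k, rfl⟩ | ⟨i, ho, rfl⟩ | ⟨i, b, ⟨j, hj, rfl⟩, rfl⟩)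
    · exact ⟨.inl k, (Fintype.equivFin g.Base k).2.trans ht, rfl⟩
    · exact ⟨.inr (.inl i), ⟨ho, ht⟩, rfl⟩
    · exact ⟨.inr (.inr (i, j)), hj, rfl⟩

theorem seqGraph_eq_of_le (g : Gadget V n) {d t : ℕ} (ht : t ≤ g.size) (o o' : Option (Fin n))
    (y y' : Fin n → Fin d → Bool) : g.seqGraph o y t = g.seqGraph o' y' t := by
  have key : ∀ (o o' : Option (Fin n)) (y y' : Fin n → Fin d → Bool) (a : Sym2 V),
      (∃ l, g.active d o t l ∧ a = g.labelEdge y l) →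
      ∃ l, g.active d o' t l ∧ a = g.labelEdge y' l := by
    rintro o o' y y' a ⟨k | i | ⟨i, j⟩, hl, rfl⟩
    · exact ⟨.inl k, hl, rfl⟩
    · exact absurd hl.2 (by omega)
    · have := hl.1
      unfold toggleTime at this
      omega
  rw [seqGraph, seqGraph]
  congr 1
  ext a
  exact ⟨key o o' y y' a, key o' o y' y a⟩

/-- The time step at which phase `j` is evaluated. -/
def queryTime (g : Gadget V n) (d T : ℕ) (hT : g.size + 1 + 2 * n * d ≤ T) (j : Fin d) : Fin T :=
  -- The graph read here has time `g.size + 1 + 2 * n * j + n`, the only time of phase `j` at which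
  -- the toggles of all `n` gadgets are scheduled as present.
  ⟨g.size + 2 * n * j + n, by have := block_lt n j.2; omega⟩

theorem seq_graph_queryTime (g : Gadget V n) {d T : ℕ} (hT : g.size + 1 + 2 * n * d ≤ T)
    (o : Option (Fin n)) (y : Fin n → Fin d → Bool) (j : Fin d) :
    (g.seq T o y).graph (g.queryTime d T hT j).succ =
      g.stateGraph o fun i => some (y i j) := by
  have : (g.seq T o y).graph (g.queryTime d T hT j).succ =
      g.seqGraph o y (g.size + 2 * n * j + n + 1) := rfl
  rw [this, g.seqGraph_eq_stateGraph (by omega)]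
  congr 1
  funext i
  refine g.toggleState_eq_some y ?_
  have := i.2
  unfold toggleTime
  omega

/-- The probe edges are proper edges and different from all other edges, and inserting the probe
edge of a gadget hides the choice of its toggle edge from `f`. -/
structure IsHiding {β : Type*} (g : Gadget V n) (f : SimpleGraph V → β) : Prop where
  not_isDiag : ∀ i, ¬(g.probe i).IsDiag
  ne_base : ∀ i k, g.probe i ≠ g.base k
  ne_toggle : ∀ i i' b, g.probe i ≠ g.toggle i' b
  hides : ∀ i w w', (∀ i' ≠ i, w i' = w' i') → (w i).isSome = (w' i).isSome →
    f (g.stateGraph (some i) w) = f (g.stateGraph (some i) w')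

namespace IsHiding

variable {β : Type*} {g : Gadget V n} {f : SimpleGraph V → β}

/-- The times at which toggles are present do not depend on the data. Changing record `i` therefore
only changes which toggle gadget `i` carries, which its probe hides. -/
theorem outputs_eq (h : g.IsHiding f) {d T : ℕ} {i : Fin n} {y y' : Fin n → Fin d → Bool}
    (hy : ∀ i' ≠ i, y i' = y' i') :
    (g.seq T (some i) y).outputs f = (g.seq T (some i) y').outputs f := by
  funext t
  change f (g.seqGraph (some i) y _) = f (g.seqGraph (some i) y' _)
  rcases le_or_gt ((Fin.succ t : Fin (T + 1)) : ℕ) g.size with ht | ht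
  · rw [g.seqGraph_eq_of_le ht]
  · rw [g.seqGraph_eq_stateGraph ht, g.seqGraph_eq_stateGraph ht]
    refine h.hides i _ _ (fun i' hi' => ?_) ?_
    · simp only [toggleState, hy i' hi']
    · simp only [toggleState]
      split <;> rfl

theorem edgeSet_seqGraph (h : g.IsHiding f) {d : ℕ} (i : Fin n) (y : Fin n → Fin d → Bool)
    (t : ℕ) (a : Sym2 V) : a ∈ (g.seqGraph (some i) y t).edgeSet ↔
      a ∈ (g.seqGraph none y t).edgeSet ∨ (a = g.probe i ∧ g.size < t) := by
  simp only [seqGraph, SimpleGraph.edgeSet_fromEdgeSet, Set.mem_sdiff, Set.mem_ofPred_eq]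
  constructor
  · rintro ⟨⟨k | i' | ⟨i', j⟩, hl, rfl⟩, hd⟩
    · exact Or.inl ⟨⟨.inl k, hl, rfl⟩, hd⟩
    · have : i = i' := by simpa using hl.1
      subst this
      exact Or.inr ⟨rfl, hl.2⟩
    · exact Or.inl ⟨⟨.inr (.inr (i', j)), hl, rfl⟩, hd⟩
  · rintro (⟨⟨k | i' | ⟨i', j⟩, hl, rfl⟩, hd⟩ | ⟨rfl, ht⟩)
    · exact ⟨⟨.inl k, hl, rfl⟩, hd⟩
    · exact absurd hl.1 (by simp)
    · exact ⟨⟨.inr (.inr (i', j)), hl, rfl⟩, hd⟩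
    · exact ⟨⟨.inr (.inl i), ⟨rfl, ht⟩, rfl⟩, h.not_isDiag i⟩

theorem probe_notMem (h : g.IsHiding f) {d : ℕ} (i : Fin n) (y : Fin n → Fin d → Bool)
    (t : ℕ) : g.probe i ∉ (g.seqGraph none y t).edgeSet := by
  simp only [seqGraph, SimpleGraph.edgeSet_fromEdgeSet, Set.mem_sdiff, Set.mem_ofPred_eq]
  rintro ⟨⟨k | i' | ⟨i', j⟩, hl, he⟩, -⟩
  · exact h.ne_base i k he
  · exact absurd hl.1 (by simp)
  · exact h.ne_toggle i i' _ he

/-- Without a probe, the time step reserved for it is a no-op. -/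
theorem seqGraph_size_succ {d : ℕ} (y : Fin n → Fin d → Bool) :
    g.seqGraph none y (g.size + 1) = g.seqGraph none y g.size := by
  rw [seqGraph, seqGraph]
  congr 1
  ext a
  constructor
  · rintro ⟨k | i' | ⟨i', j⟩, hl, rfl⟩
    · exact ⟨.inl k, (Fintype.equivFin g.Base k).2, rfl⟩
    · exact absurd hl.1 (by simp)
    · have := hl.1; unfold toggleTime at this; omega
  · rintro ⟨k | i' | ⟨i', j⟩, hl, rfl⟩
    · exact ⟨.inl k, Nat.lt_succ_of_lt hl, rfl⟩
    · exact absurd hl.1 (by simp)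
    · have := hl.1; unfold toggleTime at this; omega

theorem removesEvent (h : g.IsHiding f) {d T : ℕ} (hT : g.size < T) (i : Fin n)
    (y : Fin n → Fin d → Bool) : (g.seq T (some i) y).RemovesEvent (g.seq T none y) := by
  have hins : ∀ (o : Option (Fin n)) (t : Fin T), (g.seq T o y).inserted t =
      (g.seqGraph o y (t + 1 : ℕ)).edgeSet \ (g.seqGraph o y t).edgeSet := fun o t => rfl
  have hdel : ∀ (o : Option (Fin n)) (t : Fin T), (g.seq T o y).deleted t =
      (g.seqGraph o y t).edgeSet \ (g.seqGraph o y (t + 1 : ℕ)).edgeSet := fun o t => rfl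
  have hn := h.probe_notMem i y
  have hcase : ∀ (t : ℕ) (a : Sym2 V), a = g.probe i → a ∉ (g.seqGraph none y t).edgeSet := by
    rintro t a rfl; exact hn t
  -- The probe is never deleted, hence `t₂ = T`.
  refine ⟨g.probe i, ⟨g.size, hT⟩, T, hT, le_rfl, ?_, ?_, Or.inl ⟨?_, ?_⟩, ?_, ?_⟩
  · intro t ht _
    have ht' : (t : ℕ) ≠ g.size := fun hc => ht (Fin.ext hc)
    constructor
    · ext a
      simp only [hins, Set.mem_sdiff, h.edgeSet_seqGraph]
      have h1 := hcase t a
      have h2 := hcase (t + 1) a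
      have h3 : g.size < (t : ℕ) ↔ g.size < (t : ℕ) + 1 := by omega
      tauto
    · ext a
      simp only [hdel, Set.mem_sdiff, h.edgeSet_seqGraph]
      have h1 := hcase t a
      have h2 := hcase (t + 1) a
      have h3 : g.size < (t : ℕ) ↔ g.size < (t : ℕ) + 1 := by omega
      tauto
  · intro t ht _
    have ht' : g.size < (t : ℕ) := ht
    have ht'' : g.size < (t : ℕ) + 1 := by omega
    simp only [DynamicGraphSequence.updated, hins, hdel, Set.mem_union, Set.mem_sdiff,
      h.edgeSet_seqGraph]
    tauto
  · ext a
    simp only [hins, Set.mem_sdiff, h.edgeSet_seqGraph, seqGraph_size_succ, Set.mem_singleton_iff]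
    have h1 := hcase g.size a
    have h2 : g.size < g.size + 1 := by omega
    have h3 : ¬ g.size < g.size := by omega
    tauto
  · intro t ht
    exact absurd t.2 (by omega)
  · simp only [DynamicGraphSequence.updated, hins, hdel, seqGraph_size_succ]
    simp
  · intro t ht
    exact absurd t.2 (by omega)

end IsHiding

/-- Private algorithms for `f` answer marginals of data sets encoded by a hiding gadget. -/
theorem IsHiding.isPrivateMarginals {k : ℕ} {g : Gadget V n} {f : SimpleGraph V → Fin k → ℝ}
    (h : g.IsHiding f) {d T : ℕ} (hT : g.size + 1 + 2 * n * d ≤ T) {m : Fin k} {C : ℝ}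
    (hC : ∀ b : Fin n → Bool,
      f (g.stateGraph none fun i => some (b i)) m = C + ∑ i, boolBit (b i))
    {A : ContinualReleaseAlgorithm V T k} {ε δ γ α : ℝ}
    (hdet : A.IsOutputDetermined f γ) (hdp : A.IsEventLevelEdgeDP ε δ)
    (hacc : A.IsAccurate f α (1 / 3)) :
    IsPrivateMarginals (fun y : Fin n → Fin d → Bool => A.law (g.seq T none y))
      (fun a j => a (g.queryTime d T hT j) m - C) (Real.exp (2 * ε))
      (Real.exp ε * (δ + γ) + δ) α where
  prob y := A.isProbabilityMeasure_law _
  dp y i v U hU := by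
    have hlt : g.size < T := by omega
    set y' := Function.update y i v
    have hy : ∀ i' ≠ i, y i' = y' i' := fun i' hi' => by simp [y', hi']
    have h1 := hdp _ _ (Or.inr (h.removesEvent hlt i y)) U hU
    have h2 := hdet _ _ (h.outputs_eq (T := T) hy) U hU
    have h3 := hdp _ _ (Or.inl (h.removesEvent hlt i y')) U hU
    have he := (Real.exp_pos ε).le
    -- The chain is: insert the probe, exchange the record, remove the probe. The losses of the last
    -- two links are multiplied by `exp ε` from the first.
    have h4 := mul_le_mul_of_nonneg_left (h2.trans (add_le_add_left h3 γ)) he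
    rw [two_mul, Real.exp_add]
    linarith
  measurable j := by
    refine Measurable.sub_const ?_ C
    exact (measurable_pi_apply m).comp (measurable_pi_apply _)
  accurate y := by
    have := A.isProbabilityMeasure_law (g.seq T none y)
    refine (measureReal_mono ?_).trans (hacc (g.seq T none y))
    rintro a ⟨j, hj⟩
    refine ⟨g.queryTime d T hT j, hj.trans_le ?_⟩
    have hn := norm_le_pi_norm
      (a (g.queryTime d T hT j) - (g.seq T none y).outputs f (g.queryTime d T hT j)) m
    refine le_trans (le_of_eq ?_) hn
    rw [DynamicGraphSequence.outputs, g.seq_graph_queryTime hT, Pi.sub_apply, hC, Real.norm_eq_abs]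
    congr 1
    ring

end Gadget

/-! ### Graph parameters of simple graphs -/

namespace SimpleGraph

/-- Weak König duality: the centres in `s` form a vertex cover of the same size as the matching of
centres to leaves. -/
theorem maxMatchingSize_eq_card {V ι : Type*} [Fintype V] {G : SimpleGraph V} {c leaf : ι → V}
    (s : Finset ι) (hc : Function.Injective c) (hleaf : Function.Injective leaf)
    (hne : ∀ i j, c i ≠ leaf j) (hadj : ∀ i ∈ s, G.Adj (c i) (leaf i))
    (hcover : ∀ u v, G.Adj u v → ∃ i ∈ s, c i = u ∨ c i = v) :
    G.maxMatchingSize = s.card := by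
  have hgreat : IsGreatest {n | ∃ M : G.Subgraph, M.IsMatching ∧ M.edgeSet.ncard = n} s.card := by
    constructor
    · let f : s → G.Subgraph := fun i => G.subgraphOfAdj (hadj i i.2)
      refine ⟨⨆ i, f i, Subgraph.IsMatching.iSup (fun i => .subgraphOfAdj _) ?_, ?_⟩
      · intro i j hij
        have hij' : (i : ι) ≠ j := fun h => hij (Subtype.ext h)
        refine Set.disjoint_of_subset (Subgraph.support_subset_verts _)
          (Subgraph.support_subset_verts _) (Set.disjoint_left.2 ?_)
        rintro v (rfl | rfl) (h | h)
        · exact hij' (hc h)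
        · exact hne _ _ h
        · exact hne _ _ h.symm
        · exact hij' (hleaf h)
      · rw [Subgraph.edgeSet_iSup]
        have : (⋃ i, (f i).edgeSet) = Set.range fun i : s => s(c i, leaf i) := by
          ext a; simp [f]
        rw [this, ← Set.image_univ, Set.ncard_image_of_injective, Set.ncard_univ]
        · simp
        · intro i j hij
          simp only [Sym2.eq_iff] at hij
          rcases hij with ⟨h, -⟩ | ⟨h, -⟩
          · exact Subtype.ext (hc h)
          · exact absurd h (hne _ _)
    · rintro m ⟨M, hM, rfl⟩
      have hex : ∀ a : M.edgeSet, ∃ i ∈ s, c i ∈ (a : Sym2 V) := by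
        rintro ⟨a, ha⟩
        induction a with
        | _ u v =>
          obtain ⟨i, hi, h⟩ := hcover u v (M.adj_sub ha)
          exact ⟨i, hi, by simpa [eq_comm] using h⟩
      choose F hF1 hF2 using hex
      have hinj : Function.Injective F := by
        intro a b hab
        have ha := hF2 a
        have hb := hF2 b
        rw [← hab] at hb
        obtain ⟨v, hv⟩ := ha
        obtain ⟨w, hw⟩ := hb
        have hav : M.Adj (c (F a)) v := by have := a.2; rwa [hv] at this
        have hbw : M.Adj (c (F a)) w := by have := b.2; rwa [hw] at this
        have : v = w := (hM (M.edge_vert hav)).unique hav hbw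
        exact Subtype.ext (by rw [hv, hw, this])
      have := Nat.card_le_card_of_injective (fun a => (⟨F a, hF1 a⟩ : s))
        fun a b hab => hinj (congrArg Subtype.val hab)
      simpa using this
  exact hgreat.csSup_eq

/-- All non-isolated nodes lie in the component of `p`; the isolated ones are components by
themselves. -/
theorem numComponents_eq {V : Type*} [Fintype V] {G : SimpleGraph V} {p q : V} (hpq : G.Adj p q)
    (h : ∀ u v, G.Adj u v → G.Reachable u p) :
    G.numComponents = Nat.card {v // ∀ u, ¬G.Adj v u} + 1 := by
  rw [numComponents, ← Finite.card_option]
  symm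
  refine Nat.card_congr (Equiv.ofBijective (fun x : Option {v // ∀ u, ¬G.Adj v u} =>
    G.connectedComponentMk (x.elim p Subtype.val)) ⟨?_, ?_⟩)
  · have key : ∀ {v w : V}, (∀ u, ¬G.Adj v u) → G.Reachable v w → v = w := by
      rintro v w hv ⟨W⟩
      cases W with
      | nil => rfl
      | cons hvw _ => exact absurd hvw (hv _)
    rintro (_ | ⟨v, hv⟩) (_ | ⟨w, hw⟩) hx
    · rfl
    · have : w = p := key hw (ConnectedComponent.exact hx).symm
      subst this
      exact absurd hpq (hw q)
    · have : v = p := key hv (ConnectedComponent.exact hx)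
      subst this
      exact absurd hpq (hv q)
    · have : v = w := key hv (ConnectedComponent.exact hx)
      subst this
      rfl
  · intro C
    induction C using ConnectedComponent.ind with
    | _ v =>
      by_cases hv : ∀ u, ¬G.Adj v u
      · exact ⟨some ⟨v, hv⟩, rfl⟩
      · push Not at hv
        obtain ⟨u, hu⟩ := hv
        exact ⟨none, ConnectedComponent.sound (h v u hu).symm⟩

theorem degreeCount_eq_of_iso {V : Type*} [Fintype V] {G H : SimpleGraph V} (e : G ≃g H) (j : ℕ) :
    G.degreeCount j = H.degreeCount j := by
  classical
  refine Finset.card_equiv e.toEquiv fun v => ?_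
  simp only [Finset.mem_filter, Finset.mem_univ, true_and]
  rw [show e.toEquiv v = e v from rfl, e.degree_eq]

end SimpleGraph

namespace Gadget

theorem stateGraph_adj {V : Type*} {n : ℕ} (g : Gadget V n) (o : Option (Fin n))
    (w : Fin n → Option Bool) (u v : V) : (g.stateGraph o w).Adj u v ↔
      ((∃ k, s(u, v) = g.base k) ∨ (∃ i, o = some i ∧ s(u, v) = g.probe i) ∨
        ∃ i b, w i = some b ∧ s(u, v) = g.toggle i b) ∧ u ≠ v := by
  rw [stateGraph, SimpleGraph.fromEdgeSet_adj]
  rfl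

theorem sum_boolBit {n : ℕ} (b : Fin n → Bool) :
    ∑ i, boolBit (b i) = ((Finset.univ.filter fun i => b i = true).card : ℝ) := by
  simp [boolBit]

/-! ### Maximum matching -/

section Matching

variable {V : Type*} {n : ℕ}

/-- Each gadget is a path with two edges; one is the probe edge, the other one is toggled. -/
def matching (φ : Fin n × Fin 3 ↪ V) : Gadget V n where
  Base := Empty
  fintypeBase := inferInstance
  base := Empty.elim
  probe i := s(φ (i, 0), φ (i, 1))
  toggle i b := if b then s(φ (i, 1), φ (i, 2)) else s(φ (i, 1), φ (i, 1))

/-- Both edges of a gadget share its middle node, so a gadget contributes at most one matching edge,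
and the probe already provides it. -/
theorem matching_maxMatchingSize [Fintype V] (φ : Fin n × Fin 3 ↪ V) (o : Option (Fin n))
    (w : Fin n → Option Bool) : ((matching φ).stateGraph o w).maxMatchingSize =
      (Finset.univ.filter fun i => o = some i ∨ w i = some true).card := by
  have hφ := φ.injective
  refine SimpleGraph.maxMatchingSize_eq_card (c := fun i => φ (i, 1))
    (leaf := fun i => if o = some i then φ (i, 0) else φ (i, 2)) _ ?_ ?_ ?_ ?_ ?_
  · intro i j h; simpa using hφ h
  · intro i j h
    dsimp only at h
    split_ifs at h <;> simpa using hφ h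
  · intro i j h
    split_ifs at h <;> simpa using hφ h
  · intro i hi
    simp only [Finset.mem_filter, Finset.mem_univ, true_and] at hi
    rw [stateGraph_adj]
    by_cases ho : o = some i
    · rw [if_pos ho]
      exact ⟨Or.inr (Or.inl ⟨i, ho, Sym2.eq_swap⟩), by simp [hφ.eq_iff]⟩
    · rw [if_neg ho]
      exact ⟨Or.inr (Or.inr ⟨i, true, hi.resolve_left ho, rfl⟩), by simp [hφ.eq_iff]⟩
  · intro u v h
    rw [stateGraph_adj] at h
    obtain ⟨⟨k, -⟩ | ⟨i, ho, h⟩ | ⟨i, b, hb, h⟩, hne⟩ := h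
    · exact k.elim
    · refine ⟨i, by simp [ho], ?_⟩
      have : s(u, v) = s(φ (i, 0), φ (i, 1)) := h
      rw [Sym2.eq_iff] at this
      tauto
    · cases b with
      | false =>
        have : s(u, v) = s(φ (i, 1), φ (i, 1)) := h
        rw [Sym2.eq_iff] at this
        exact absurd (by rcases this with h | h <;> rw [h.1, h.2]) hne
      | true =>
        refine ⟨i, by simp [hb], ?_⟩
        have : s(u, v) = s(φ (i, 1), φ (i, 2)) := h
        rw [Sym2.eq_iff] at this
        tauto

theorem matching_isHiding {N : ℕ} (φ : Fin n × Fin 3 ↪ Fin N) :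
    (matching φ).IsHiding (GraphProblem.maximumMatching.value N) where
  not_isDiag i := by simp [matching]
  ne_base i k := k.elim
  ne_toggle i i' b := by cases b <;> simp [matching]
  hides i w w' h _ := by
    funext m
    simp only [GraphProblem.value, matching_maxMatchingSize]
    congr 2
    refine Finset.filter_congr fun i' _ => ?_
    by_cases hi : i' = i
    · subst hi; simp
    · rw [h i' hi]

end Matching

/-! ### Connected components -/

section Components

variable {V : Type*} {n : ℕ}

/-- Two adjacent hubs; each gadget is a node attached to one hub by the probe edge and to the other
one by the toggle edge. -/
def components (φ : Bool ⊕ Fin n ↪ V) : Gadget V n where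
  Base := Unit
  fintypeBase := inferInstance
  base _ := s(φ (.inl true), φ (.inl false))
  probe i := s(φ (.inr i), φ (.inl true))
  toggle i b := if b then s(φ (.inr i), φ (.inr i)) else s(φ (.inr i), φ (.inl false))

theorem components_adj (φ : Bool ⊕ Fin n ↪ V) (o : Option (Fin n)) (w : Fin n → Option Bool)
    (u v : V) : ((components φ).stateGraph o w).Adj u v ↔
      s(u, v) = s(φ (.inl true), φ (.inl false)) ∨
      (∃ i, o = some i ∧ s(u, v) = s(φ (.inr i), φ (.inl true))) ∨
      ∃ i, w i = some false ∧ s(u, v) = s(φ (.inr i), φ (.inl false)) := by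
  have hφ := φ.injective
  rw [stateGraph_adj]
  constructor
  · rintro ⟨⟨k, h⟩ | ⟨i, ho, h⟩ | ⟨i, b, hb, h⟩, hne⟩
    · exact Or.inl h
    · exact Or.inr (Or.inl ⟨i, ho, h⟩)
    · cases b with
      | false => exact Or.inr (Or.inr ⟨i, hb, h⟩)
      | true =>
        have : s(u, v) = s(φ (.inr i), φ (.inr i)) := h
        rw [Sym2.eq_iff] at this
        exact absurd (by rcases this with h | h <;> rw [h.1, h.2]) hne
  · have hne : ∀ {a b}, s(u, v) = s(φ a, φ b) → a ≠ b → u ≠ v := by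
      rintro a b h hab rfl
      rw [Sym2.eq_iff] at h
      exact hab (hφ (by rcases h with h | h <;> rw [← h.1, ← h.2]))
    rintro (h | ⟨i, ho, h⟩ | ⟨i, hb, h⟩)
    · exact ⟨Or.inl ⟨(), h⟩, hne h (by simp)⟩
    · exact ⟨Or.inr (Or.inl ⟨i, ho, h⟩), hne h (by simp)⟩
    · exact ⟨Or.inr (Or.inr ⟨i, false, hb, h⟩), hne h (by simp)⟩

/-- The hubs are adjacent, so a gadget node attached to either one joins the same component; the
rest is isolated. -/
theorem components_numComponents [Fintype V] (φ : Bool ⊕ Fin n ↪ V) (o : Option (Fin n))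
    (w : Fin n → Option Bool) : ((components φ).stateGraph o w).numComponents + 1 +
      (Finset.univ.filter fun i => o = some i ∨ w i = some false).card = Fintype.card V := by
  classical
  set G := (components φ).stateGraph o w with hG
  set s := Finset.univ.filter fun i => o = some i ∨ w i = some false with hs
  have hφ := φ.injective
  have hpq : G.Adj (φ (.inl true)) (φ (.inl false)) := by
    rw [hG, components_adj]; exact Or.inl rfl
  have hreach : ∀ u v, G.Adj u v → G.Reachable u (φ (.inl true)) := by
    intro u v h
    have huv := h.reachable
    rw [hG, components_adj] at h
    rcases h with h | ⟨i, ho, h⟩ | ⟨i, hb, h⟩ <;> rw [Sym2.eq_iff] at h <;>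
      rcases h with ⟨rfl, rfl⟩ | ⟨rfl, rfl⟩
    · exact SimpleGraph.Reachable.refl _
    · exact huv
    · exact huv
    · exact SimpleGraph.Reachable.refl _
    · exact huv.trans hpq.symm.reachable
    · exact hpq.symm.reachable
  have hiso : ∀ v, (∀ u, ¬G.Adj v u) ↔ v ∉ (Finset.univ.disjSum s).map φ := by
    intro v
    rw [← not_exists, not_iff_not]
    constructor
    · rintro ⟨u, h⟩
      rw [hG, components_adj] at h
      rcases h with h | ⟨i, ho, h⟩ | ⟨i, hb, h⟩ <;> rw [Sym2.eq_iff] at h <;>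
        rcases h with ⟨rfl, rfl⟩ | ⟨rfl, rfl⟩ <;> simp [*]
    · simp only [Finset.mem_map, Finset.mem_disjSum, Finset.mem_univ, true_and]
      rintro ⟨a, ⟨b, rfl⟩ | ⟨i, hi, rfl⟩, rfl⟩
      · cases b
        · exact ⟨_, hpq.symm⟩
        · exact ⟨_, hpq⟩
      · simp only [hs, Finset.mem_filter, Finset.mem_univ, true_and] at hi
        rcases hi with hi | hi
        · exact ⟨φ (.inl true), by
            rw [hG, components_adj]; exact Or.inr (Or.inl ⟨i, hi, rfl⟩)⟩
        · exact ⟨φ (.inl false), by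
            rw [hG, components_adj]; exact Or.inr (Or.inr ⟨i, hi, rfl⟩)⟩
  rw [SimpleGraph.numComponents_eq hpq hreach]
  have hcard : Nat.card {v // ∀ u, ¬G.Adj v u} = ((Finset.univ.disjSum s).map φ)ᶜ.card := by
    rw [Nat.card_congr (Equiv.subtypeEquivRight hiso), Nat.card_eq_fintype_card,
      Fintype.card_subtype]
    congr 1
    ext v
    simp
  have hle := Finset.card_le_univ ((Finset.univ.disjSum s).map φ)
  rw [hcard, Finset.card_compl]
  rw [Finset.card_map, Finset.card_disjSum] at hle ⊢
  simp only [Finset.card_univ, Fintype.card_bool] at hle ⊢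
  omega

theorem components_isHiding {N : ℕ} (φ : Bool ⊕ Fin n ↪ Fin N) :
    (components φ).IsHiding (GraphProblem.connectedComponents.value N) where
  not_isDiag i := by simp [components]
  ne_base i k := by simp [components]
  ne_toggle i i' b := by cases b <;> simp [components]
  hides i w w' h _ := by
    funext m
    simp only [GraphProblem.value]
    congr 1
    have h1 := components_numComponents φ (some i) w
    have h2 := components_numComponents φ (some i) w'
    have h3 : (Finset.univ.filter fun i' => some i = some i' ∨ w i' = some false) =
        Finset.univ.filter fun i' => some i = some i' ∨ w' i' = some false := by
      refine Finset.filter_congr fun i' _ => ?_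
      by_cases hi : i' = i
      · subst hi; simp
      · rw [h i' hi]
    rw [h3] at h1
    omega

end Components

end Gadget

namespace Gadget

/-! ### Nodes of high degree -/

section HighDegree

variable {V : Type*} {n : ℕ}

/-- A clique of `t + 2` hubs; each gadget is a node joined to the first `t` hubs, to hub `t` by the
probe edge, and to hub `t + 1` by the toggle edge. -/
def highDegree {t : ℕ} (φ : Fin (t + 2) ⊕ Fin n ↪ V) : Gadget V n where
  Base := (Fin (t + 2) × Fin (t + 2)) ⊕ (Fin n × Fin t)
  fintypeBase := inferInstance
  base := Sum.elim (fun k => s(φ (.inl k.1), φ (.inl k.2)))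
    fun k => s(φ (.inr k.1), φ (.inl (k.2.castLE (by omega))))
  probe i := s(φ (.inr i), φ (.inl ⟨t, by omega⟩))
  toggle i b := if b then s(φ (.inr i), φ (.inl (Fin.last (t + 1)))) else
    s(φ (.inr i), φ (.inr i))

theorem highDegree_adj_hub {t : ℕ} (φ : Fin (t + 2) ⊕ Fin n ↪ V) (o : Option (Fin n))
    (w : Fin n → Option Bool) {k l : Fin (t + 2)} (h : k ≠ l) :
    ((highDegree φ).stateGraph o w).Adj (φ (.inl k)) (φ (.inl l)) := by
  rw [stateGraph_adj]
  exact ⟨Or.inl ⟨.inl (k, l), rfl⟩, fun hc => h (by simpa using φ.injective hc)⟩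

theorem highDegree_adj_node {t : ℕ} (φ : Fin (t + 2) ⊕ Fin n ↪ V) (o : Option (Fin n))
    (w : Fin n → Option Bool) (i : Fin n) (u : V) :
    ((highDegree φ).stateGraph o w).Adj (φ (.inr i)) u ↔
      ∃ k : Fin (t + 2), u = φ (.inl k) ∧
        ((k : ℕ) < t ∨ ((k : ℕ) = t ∧ o = some i) ∨ ((k : ℕ) = t + 1 ∧ w i = some true)) := by
  have hφ := φ.injective
  rw [stateGraph_adj]
  constructor
  · rintro ⟨⟨⟨k, l⟩ | ⟨j, k⟩, h⟩ | ⟨j, ho, h⟩ | ⟨j, b, hb, h⟩, hne⟩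
    · replace h : s(φ (.inr i), u) = s(φ (.inl k), φ (.inl l)) := h
      simp at h
    · replace h : s(φ (.inr i), u) = s(φ (.inr j), φ (.inl (k.castLE (by omega)))) := h
      simp at h
      exact ⟨_, h.2, Or.inl k.2⟩
    · replace h : s(φ (.inr i), u) = s(φ (.inr j), φ (.inl ⟨t, by omega⟩)) := h
      simp at h
      exact ⟨_, h.2, Or.inr (Or.inl ⟨rfl, h.1 ▸ ho⟩)⟩
    · cases b with
      | false =>
        replace h : s(φ (.inr i), u) = s(φ (.inr j), φ (.inr j)) := h
        rw [Sym2.eq_iff] at h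
        exact absurd (by rcases h with h | h <;> rw [h.1, h.2]) hne
      | true =>
        replace h : s(φ (.inr i), u) = s(φ (.inr j), φ (.inl (Fin.last (t + 1)))) := h
        simp at h
        exact ⟨_, h.2, Or.inr (Or.inr ⟨rfl, h.1 ▸ hb⟩)⟩
  · rintro ⟨k, rfl, hk⟩
    refine ⟨?_, by simp⟩
    rcases hk with hk | ⟨hk, ho⟩ | ⟨hk, hw⟩
    · exact Or.inl ⟨.inr (i, ⟨k, hk⟩), rfl⟩
    · refine Or.inr (Or.inl ⟨i, ho, ?_⟩)
      rw [show k = ⟨t, by omega⟩ from Fin.ext hk]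
      rfl
    · refine Or.inr (Or.inr ⟨i, true, hw, ?_⟩)
      rw [show k = Fin.last (t + 1) from Fin.ext hk]
      rfl

theorem highDegree_mem_range_of_adj {t : ℕ} (φ : Fin (t + 2) ⊕ Fin n ↪ V) (o : Option (Fin n))
    (w : Fin n → Option Bool) {u v : V} (h : ((highDegree φ).stateGraph o w).Adj u v) :
    u ∈ Set.range φ := by
  rw [stateGraph_adj] at h
  have key : ∀ {a b}, s(u, v) = s(φ a, φ b) → u ∈ Set.range φ := by
    intro a b h
    rw [Sym2.eq_iff] at h
    rcases h with h | h <;> rw [h.1] <;> exact ⟨_, rfl⟩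
  obtain ⟨⟨k | k, h⟩ | ⟨j, ho, h⟩ | ⟨j, b, hb, h⟩, hne⟩ := h
  · exact key h
  · exact key h
  · exact key h
  · cases b <;> exact key h

-- Base edges give each gadget node degree `t`, so either extra edge reaches the threshold `t + 1`.
-- The hubs reach it through their clique alone.
open scoped Classical in
theorem highDegree_highDegreeCount [Fintype V] {t : ℕ} (φ : Fin (t + 2) ⊕ Fin n ↪ V)
    (o : Option (Fin n)) (w : Fin n → Option Bool) :
    ((highDegree φ).stateGraph o w).highDegreeCount (t + 1) =
      t + 2 + (Finset.univ.filter fun i => o = some i ∨ w i = some true).card := by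
  set G := (highDegree φ).stateGraph o w with hG
  have hφ := φ.injective
  have hub : ∀ k, t + 1 ≤ G.degree (φ (.inl k)) := by
    intro k
    rw [← G.card_neighborFinset_eq_degree]
    calc t + 1 = (((Finset.univ.erase k).map .inl).map φ).card := by simp
      _ ≤ _ := by
        refine Finset.card_le_card fun v hv => ?_
        simp only [Finset.mem_map, Finset.mem_erase] at hv
        obtain ⟨_, ⟨l, ⟨hl, -⟩, rfl⟩, rfl⟩ := hv
        rw [SimpleGraph.mem_neighborFinset]
        exact highDegree_adj_hub φ o w hl.symm
  have node : ∀ i, t + 1 ≤ G.degree (φ (.inr i)) ↔ (o = some i ∨ w i = some true) := by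
    intro i
    have hnb : G.neighborFinset (φ (.inr i)) = ((Finset.univ.filter fun k : Fin (t + 2) =>
        (k : ℕ) < t ∨ ((k : ℕ) = t ∧ o = some i) ∨ ((k : ℕ) = t + 1 ∧ w i = some true)).map
          .inl).map φ := by
      ext u
      rw [SimpleGraph.mem_neighborFinset, hG, highDegree_adj_node]
      simp [eq_comm, and_comm]
    have hlt : (Finset.univ.filter fun k : Fin (t + 2) => (k : ℕ) < t).card = t := by
      rw [Fin.card_filter_val_lt]; simp
    rw [← G.card_neighborFinset_eq_degree, hnb, Finset.card_map, Finset.card_map]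
    constructor
    · intro h
      by_contra hcon
      push Not at hcon
      simp only [hcon.1, hcon.2, and_false, or_false, hlt] at h
      omega
    · have key : ∀ m : Fin (t + 2), t ≤ m → ((m : ℕ) < t ∨ ((m : ℕ) = t ∧ o = some i) ∨
          ((m : ℕ) = t + 1 ∧ w i = some true)) → t + 1 ≤ (Finset.univ.filter fun k : Fin (t + 2) =>
          (k : ℕ) < t ∨ ((k : ℕ) = t ∧ o = some i) ∨ ((k : ℕ) = t + 1 ∧ w i = some true)).card := by
        intro m hm h
        calc t + 1 = (insert m (Finset.univ.filter fun k : Fin (t + 2) => (k : ℕ) < t)).card := by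
              rw [Finset.card_insert_of_notMem (by simpa using hm), hlt]
          _ ≤ _ := by
              refine Finset.card_le_card fun k hk => ?_
              simp only [Finset.mem_insert, Finset.mem_filter, Finset.mem_univ, true_and] at hk ⊢
              rcases hk with rfl | hk
              · exact h
              · exact Or.inl hk
      rintro (h | h)
      · exact key ⟨t, by omega⟩ le_rfl (Or.inr (Or.inl ⟨rfl, h⟩))
      · exact key (Fin.last (t + 1)) (by simp) (Or.inr (Or.inr ⟨rfl, h⟩))
  have hset : (Finset.univ.filter fun v => t + 1 ≤ G.degree v) =
      (Finset.univ.disjSum (Finset.univ.filter fun i => o = some i ∨ w i = some true)).map φ := by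
    ext v
    simp only [Finset.mem_filter, Finset.mem_univ, true_and, Finset.mem_map, Finset.mem_disjSum]
    constructor
    · intro hv
      have hpos : 0 < G.degree v := by omega
      obtain ⟨u, hu⟩ := (G.degree_pos_iff_exists_adj v).1 hpos
      obtain ⟨a, rfl⟩ := highDegree_mem_range_of_adj φ o w hu
      refine ⟨a, ?_, rfl⟩
      rcases a with k | i
      · exact Or.inl ⟨k, rfl⟩
      · exact Or.inr ⟨i, (node i).1 hv, rfl⟩
    · rintro ⟨_, ⟨k, rfl⟩ | ⟨i, hi, rfl⟩, rfl⟩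
      · exact hub k
      · exact (node i).2 hi
  have hdef : G.highDegreeCount (t + 1) = (Finset.univ.filter fun v => t + 1 ≤ G.degree v).card :=
    rfl
  rw [hdef, hset, Finset.card_map, Finset.card_disjSum]
  simp

theorem highDegree_isHiding {N t : ℕ} (φ : Fin (t + 2) ⊕ Fin n ↪ Fin N) :
    (highDegree φ).IsHiding ((GraphProblem.highDegree t.succPNat).value N) where
  not_isDiag i := by simp [highDegree]
  ne_base i k := by
    rcases k with k | k
    · simp [highDegree]
    · have := k.2.2
      simp only [highDegree, Sum.elim_inr, ne_eq, Sym2.eq_iff, φ.injective.eq_iff]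
      simp [Fin.ext_iff]
      omega
  ne_toggle i i' b := by
    cases b <;> simp [highDegree, Fin.ext_iff]
  hides i w w' h _ := by
    classical
    funext m
    simp only [GraphProblem.value, Nat.succPNat_coe, Nat.succ_eq_add_one,
      highDegree_highDegreeCount]
    congr 3
    refine Finset.filter_congr fun i' _ => ?_
    by_cases hi : i' = i
    · subst hi; simp
    · rw [h i' hi]

end HighDegree

/-! ### Degree histogram -/

section Histogram

variable {V : Type*} {n : ℕ}

/-- The node `0` of each gadget is joined to one of the nodes `1` and `3` by a toggle edge. The base
edge joins the nodes `1` and `2`, and the probe edge joins the nodes `2` and `3`. -/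
def histogram (φ : Fin n × Fin 4 ↪ V) : Gadget V n where
  Base := Fin n
  fintypeBase := inferInstance
  base i := s(φ (i, 1), φ (i, 2))
  probe i := s(φ (i, 2), φ (i, 3))
  toggle i b := if b then s(φ (i, 0), φ (i, 1)) else s(φ (i, 0), φ (i, 3))

/-- With the probe, nodes `1, 2, 3` form a path and node `0` hangs on one end. Reversing the path
exchanges the two toggles, and also the base and probe edges. -/
theorem histogram_adj_swap [DecidableEq V] (φ : Fin n × Fin 4 ↪ V) {i : Fin n}
    {w w' : Fin n → Option Bool} (h : ∀ i' ≠ i, w i' = w' i') {b : Bool} (hw : w i = some b)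
    (hw' : w' i = some (!b)) {u v : V} (huv : ((histogram φ).stateGraph (some i) w).Adj u v) :
    ((histogram φ).stateGraph (some i) w').Adj (Equiv.swap (φ (i, 1)) (φ (i, 3)) u)
      (Equiv.swap (φ (i, 1)) (φ (i, 3)) v) := by
  rw [stateGraph_adj] at huv ⊢
  obtain ⟨huv, hne⟩ := huv
  refine ⟨?_, fun hc => hne (Equiv.injective _ hc)⟩
  set σ := Equiv.swap (φ (i, 1)) (φ (i, 3)) with hσ
  have hmap : s(σ u, σ v) = Sym2.map σ s(u, v) := rfl
  have h1 : σ (φ (i, 1)) = φ (i, 3) := Equiv.swap_apply_left _ _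
  have h3 : σ (φ (i, 3)) = φ (i, 1) := Equiv.swap_apply_right _ _
  have hfix : ∀ j k, j ≠ i ∨ (k ≠ 1 ∧ k ≠ 3) → σ (φ (j, k)) = φ (j, k) := by
    intro j k hjk
    refine Equiv.swap_apply_of_ne_of_ne ?_ ?_ <;> rw [φ.injective.ne_iff] <;> intro hc <;>
      rw [Prod.mk.injEq] at hc <;> tauto
  rw [hmap]
  rcases huv with ⟨k, h'⟩ | ⟨j, ho, h'⟩ | ⟨j, c, hc, h'⟩ <;> rw [h']
  · by_cases hk : k = i
    · subst hk
      refine Or.inr (Or.inl ⟨k, rfl, ?_⟩)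
      simp [histogram, h1, hfix k 2 (Or.inr (by decide)), Sym2.eq_swap]
    · refine Or.inl ⟨k, ?_⟩
      simp [histogram, hfix k _ (Or.inl hk)]
  · have : i = j := by simpa using ho
    subst this
    refine Or.inl ⟨i, ?_⟩
    simp [histogram, h3, hfix i 2 (Or.inr (by decide)), Sym2.eq_swap]
  · by_cases hj : j = i
    · subst hj
      refine Or.inr (Or.inr ⟨j, !b, hw', ?_⟩)
      have : b = c := by simpa [hw] using hc
      subst this
      cases b <;> simp [histogram, h1, h3, hfix j 0 (Or.inr (by decide))]
    · refine Or.inr (Or.inr ⟨j, c, by rw [← h j hj, hc], ?_⟩)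
      cases c <;> simp [histogram, hfix j _ (Or.inl hj)]

theorem histogram_degreeCount_eq [Fintype V] (φ : Fin n × Fin 4 ↪ V) {i : Fin n}
    {w w' : Fin n → Option Bool} (h : ∀ i' ≠ i, w i' = w' i')
    (hs : (w i).isSome = (w' i).isSome) (j : ℕ) :
    ((histogram φ).stateGraph (some i) w).degreeCount j =
      ((histogram φ).stateGraph (some i) w').degreeCount j := by
  classical
  by_cases hi : w i = w' i
  · have : w = w' := by
      funext i'
      by_cases hc : i' = i
      · rw [hc, hi]
      · exact h i' hc
    rw [this]
  · obtain ⟨b, hb, hb'⟩ : ∃ b, w i = some b ∧ w' i = some (!b) := by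
      rcases hw : w i with _ | b <;> rcases hw' : w' i with _ | b' <;> simp_all
      cases b <;> cases b' <;> simp_all
    refine SimpleGraph.degreeCount_eq_of_iso
      ⟨Equiv.swap (φ (i, 1)) (φ (i, 3)), fun {u v} => ⟨fun huv => ?_, fun huv => ?_⟩⟩ j
    · have := histogram_adj_swap φ (fun i' hi' => (h i' hi').symm) hb' (by simpa using hb) huv
      simpa using this
    · exact histogram_adj_swap φ h hb hb' huv

theorem histogram_adj (φ : Fin n × Fin 4 ↪ V) (b : Fin n → Bool) (u v : V) :
    ((histogram φ).stateGraph none fun i => some (b i)).Adj u v ↔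
      (∃ i, s(u, v) = s(φ (i, 1), φ (i, 2))) ∨
      ∃ i, s(u, v) = s(φ (i, 0), φ (i, if b i then 1 else 3)) := by
  rw [stateGraph_adj]
  have hne : ∀ {a b}, s(u, v) = s(φ a, φ b) → a ≠ b → u ≠ v := by
    rintro a b h hab rfl
    rw [Sym2.eq_iff] at h
    exact hab (φ.injective (by rcases h with h | h <;> rw [← h.1, ← h.2]))
  have htog : ∀ i, (histogram φ).toggle i (b i) = s(φ (i, 0), φ (i, if b i then 1 else 3)) := by
    intro i
    cases hb : b i <;> simp [histogram]
  constructor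
  · rintro ⟨⟨k, h⟩ | ⟨i, ho, h⟩ | ⟨i, c, hc, h⟩, -⟩
    · exact Or.inl ⟨k, h⟩
    · simp at ho
    · have : b i = c := by simpa using hc
      subst this
      exact Or.inr ⟨i, h.trans (htog i)⟩
  · rintro (⟨k, h⟩ | ⟨i, h⟩)
    · exact ⟨Or.inl ⟨k, h⟩, hne h (by simp)⟩
    · refine ⟨Or.inr (Or.inr ⟨i, b i, rfl, h.trans (htog i).symm⟩), hne h ?_⟩
      cases b i <;> simp

-- Without probes, a gadget is the path `0, 1, 2` if its bit is true and two disjoint edges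
-- otherwise; only the middle node `1` of the path has degree 2.
open scoped Classical in
theorem histogram_degreeCount_two [Fintype V] (φ : Fin n × Fin 4 ↪ V) (b : Fin n → Bool) :
    ((histogram φ).stateGraph none fun i => some (b i)).degreeCount 2 =
      (Finset.univ.filter fun i => b i = true).card := by
  set G := (histogram φ).stateGraph none fun i => some (b i) with hG
  have hφ := φ.injective
  have hset : (Finset.univ.filter fun v => G.degree v = 2) =
      (Finset.univ.filter fun i => b i = true).image fun i => φ (i, 1) := by
    ext v
    simp only [Finset.mem_filter, Finset.mem_univ, true_and, Finset.mem_image]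
    rw [← G.card_neighborFinset_eq_degree]
    constructor
    · intro hv
      by_contra hcon
      push Not at hcon
      have : (G.neighborFinset v).card ≤ 1 := by
        rw [Finset.card_le_one]
        intro x hx y hy
        rw [SimpleGraph.mem_neighborFinset, hG, histogram_adj] at hx hy
        clear hG
        rcases hx with ⟨i, hx⟩ | ⟨i, hx⟩ <;> rcases hy with ⟨j, hy⟩ | ⟨j, hy⟩ <;>
          rw [Sym2.eq_iff] at hx hy <;>
          rcases hx with ⟨rfl, rfl⟩ | ⟨rfl, rfl⟩ <;>
          rcases hy with ⟨h1, rfl⟩ | ⟨h1, rfl⟩ <;>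
          rw [hφ.eq_iff, Prod.mk.injEq] at h1 <;>
          obtain ⟨rfl, h2⟩ := h1 <;>
          have hi := hcon i <;> clear hcon hv <;> cases hb : b i <;>
          simp only [hb, if_true, if_false, Bool.false_eq_true] at h2 hi ⊢ <;>
          first | rfl | exact absurd h2 (by decide) | exact absurd rfl (hi trivial)
      omega
    · rintro ⟨i, hi, rfl⟩
      have : G.neighborFinset (φ (i, 1)) = {φ (i, 2), φ (i, 0)} := by
        ext u
        rw [SimpleGraph.mem_neighborFinset, hG, histogram_adj]
        simp only [Finset.mem_insert, Finset.mem_singleton]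
        constructor
        · rintro (⟨j, h⟩ | ⟨j, h⟩) <;> rw [Sym2.eq_iff] at h <;>
            rcases h with ⟨h1, rfl⟩ | ⟨h1, rfl⟩ <;>
            rw [hφ.eq_iff, Prod.mk.injEq] at h1 <;>
            obtain ⟨rfl, h2⟩ := h1 <;> simp_all
        · rintro (rfl | rfl)
          · exact Or.inl ⟨i, rfl⟩
          · exact Or.inr ⟨i, by rw [hi, if_pos rfl, Sym2.eq_swap]⟩
      rw [this, Finset.card_pair]
      rw [hφ.ne_iff]
      simp
  have hdef : G.degreeCount 2 = (Finset.univ.filter fun v => G.degree v = 2).card := rfl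
  rw [hdef, hset, Finset.card_image_of_injective _ fun i j h => by simpa using hφ h]

theorem histogram_isHiding {N : ℕ} (φ : Fin n × Fin 4 ↪ Fin N) :
    (histogram φ).IsHiding (GraphProblem.degreeHistogram.value N) where
  not_isDiag i := by simp [histogram]
  ne_base i k := by
    have h : ∀ k : Fin n, s(φ (i, 2), φ (i, 3)) ≠ s(φ (k, 1), φ (k, 2)) := fun k => by simp
    exact h k
  ne_toggle i i' b := by cases b <;> simp [histogram]
  hides i w w' h hs := by
    funext m
    simp only [GraphProblem.value]
    rw [histogram_degreeCount_eq φ h hs]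

end Histogram

/-! ### Gadgets for the four problems -/

/-- Only `K` depends on the problem, through `τ`. The leading coefficient `4` in the node count is
uniform, which keeps the final constant absolute. -/
theorem exists_isHiding (P : GraphProblem) : ∃ K : ℕ, ∀ N n : ℕ, 4 * n + K ≤ N →
    ∃ g : Gadget (Fin N) n, g.size ≤ K * n + K ∧ g.IsHiding (P.value N) ∧
      ∃ (m : Fin (P.dim N)) (C : ℝ), ∀ b : Fin n → Bool,
        P.value N (g.stateGraph none fun i => some (b i)) m = C + ∑ i, boolBit (b i) := by
  have emb : ∀ (W : Type) [Fintype W] (N : ℕ), Fintype.card W ≤ N → Nonempty (W ↪ Fin N) :=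
    fun W _ N h => Function.Embedding.nonempty_of_card_le (by simpa using h)
  cases P with
  | maximumMatching =>
    refine ⟨0, fun N n hN => ?_⟩
    obtain ⟨φ⟩ := emb (Fin n × Fin 3) N (by simp; omega)
    refine ⟨matching φ, ?_, matching_isHiding φ, ⟨0, Nat.one_pos⟩, 0, fun b => ?_⟩
    · exact (Fintype.card_eq_zero (α := Empty)).trans_le (Nat.zero_le _)
    · rw [sum_boolBit]
      simp [GraphProblem.value, matching_maxMatchingSize]
  | connectedComponents =>
    refine ⟨2, fun N n hN => ?_⟩
    obtain ⟨φ⟩ := emb (Bool ⊕ Fin n) N (by simp; omega)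
    refine ⟨components φ, ?_, components_isHiding φ, ⟨0, Nat.one_pos⟩, N - 1 - n, fun b => ?_⟩
    · have : (components φ).size = 1 := rfl
      omega
    · have h1 := components_numComponents φ none fun i => some (b i)
      have h2 : (Finset.univ.filter fun i => b i = true).card +
          (Finset.univ.filter fun i => none = some i ∨ some (b i) = some false).card = n := by
        have := Finset.card_filter_add_card_filter_not (s := (Finset.univ : Finset (Fin n)))
          (fun i => b i = true)
        simpa using this
      rw [Fintype.card_fin] at h1
      have h3 : (((components φ).stateGraph none fun i => some (b i)).numComponents : ℝ) + 1 + n =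
          N + (Finset.univ.filter fun i => b i = true).card := by
        exact_mod_cast (by omega)
      rw [sum_boolBit]
      simp only [GraphProblem.value]
      linarith
  | highDegree τ =>
    obtain ⟨t, rfl⟩ : ∃ t : ℕ, τ = t.succPNat := ⟨τ.natPred, (PNat.succPNat_natPred τ).symm⟩
    refine ⟨(t + 2) * (t + 2), fun N n hN => ?_⟩
    obtain ⟨φ⟩ := emb (Fin (t + 2) ⊕ Fin n) N (by simp; nlinarith)
    refine ⟨highDegree φ, ?_, highDegree_isHiding φ, ⟨0, Nat.one_pos⟩, t + 2, fun b => ?_⟩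
    · have : (highDegree φ).size = (t + 2) * (t + 2) + n * t := by
        simp only [size]
        exact (Fintype.card_congr (Equiv.refl ((Fin (t + 2) × Fin (t + 2)) ⊕ (Fin n × Fin t)))).trans
          (by simp)
      have h1 : t ≤ (t + 2) * (t + 2) := by nlinarith
      have h2 := Nat.mul_le_mul_left n h1
      rw [this]
      linarith
    · rw [sum_boolBit]
      simp only [GraphProblem.value, Nat.succPNat_coe, Nat.succ_eq_add_one,
        highDegree_highDegreeCount]
      simp
  | degreeHistogram =>
    refine ⟨3, fun N n hN => ?_⟩
    obtain ⟨φ⟩ := emb (Fin n × Fin 4) N (by simp; omega)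
    refine ⟨histogram φ, ?_, histogram_isHiding φ, ⟨2, by simp only [GraphProblem.dim]; omega⟩, 0,
      fun b => ?_⟩
    · have : (histogram φ).size = n := Fintype.card_fin n
      omega
    · rw [sum_boolBit]
      simp only [GraphProblem.value, histogram_degreeCount_two]
      simp

end Gadget

/-! ### Choice of parameters -/

theorem half_le_floor {x : ℝ} (hx : 1 ≤ x) : x / 2 ≤ (⌊x⌋₊ : ℝ) := by
  have h1 : (1 : ℝ) ≤ ⌊x⌋₊ := by exact_mod_cast Nat.one_le_floor_iff _ |>.2 hx
  have h2 := Nat.lt_floor_add_one x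
  linarith

/-- The chord of `exp` over `[0, 2]` lies above it, and `exp 2 ≤ 8`. -/
theorem exp_two_mul_sub_one_le {ε : ℝ} (h0 : 0 ≤ ε) (h1 : ε ≤ 1) :
    Real.exp (2 * ε) - 1 ≤ 7 * ε := by
  have h := convexOn_exp.2 (Set.mem_univ (0 : ℝ)) (Set.mem_univ (2 : ℝ)) (sub_nonneg.2 h1) h0
    (by ring)
  simp only [smul_eq_mul, mul_zero, zero_add, Real.exp_zero, mul_one] at h
  have h2 : Real.exp 2 ≤ 8 := by
    have := Real.exp_one_lt_d9
    have h3 := Real.exp_pos 1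
    rw [show (2 : ℝ) = 1 + 1 by norm_num, Real.exp_add]
    nlinarith
  rw [mul_comm 2 ε]
  nlinarith

/-- The number of phases for `n` records: a constant fraction of the time steps is used. -/
theorem phases_bounds {n T : ℕ} (hn : 0 < n) (hT : 8 * n ≤ T) :
    1 ≤ T / (8 * n) ∧ 8 * (n * (T / (8 * n))) ≤ T ∧ T ≤ 16 * (n * (T / (8 * n))) := by
  have h1 : 1 ≤ T / (8 * n) := (Nat.one_le_div_iff (by omega)).2 hT
  have h2 := Nat.div_mul_le_self T (8 * n)
  have h3 := Nat.lt_div_mul_add (a := T) (b := 8 * n) (by omega)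
  refine ⟨h1, by nlinarith, by nlinarith⟩

section Marginals

variable {Ω : Type*} [MeasurableSpace Ω] {n d : ℕ} {M : (Fin n → Fin d → Bool) → Measure Ω}
  {Q : Ω → Fin d → ℝ} {ε δ α : ℝ}

/-- Since `n δ ≤ 1 / 400`, the `δ` term consumes half of `d / 100`; what remains reads `√d ≤ 1400 n
ε`. -/
theorem IsPrivateMarginals.le_of_approx
    (h : IsPrivateMarginals M Q (Real.exp (2 * ε)) δ α) (hε0 : 0 ≤ ε) (hε1 : ε ≤ 1) (hδ : 0 ≤ δ)
    (hnδ : n * δ ≤ 1 / 400) (hn : 0 < n) (hd : 0 < d) (hα : α ≤ n / 100) :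
    (d : ℝ) ≤ 1960000 * (n ^ 2 * ε ^ 2) := by
  have hmain := h.le_of_accurate (Real.one_le_exp (by positivity)) hδ hn hα
  have hE := exp_two_mul_sub_one_le hε0 hε1
  have hd' : (0 : ℝ) < d := by exact_mod_cast hd
  have hs : 0 < Real.sqrt d := Real.sqrt_pos.2 hd'
  have hsq : Real.sqrt d ^ 2 = d := Real.sq_sqrt hd'.le
  have hn' : (0 : ℝ) < n := by exact_mod_cast hn
  have h1 : n * ((Real.exp (2 * ε) - 1) * Real.sqrt d) ≤ n * (7 * ε * Real.sqrt d) := by gcongr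
  have h2 : d * (n * δ) ≤ d * (1 / 400) := by gcongr
  have h3 : (d : ℝ) / 200 ≤ 7 * (n * ε) * Real.sqrt d := by nlinarith
  have h4 : Real.sqrt d ≤ 1400 * (n * ε) := by
    have : Real.sqrt d * Real.sqrt d ≤ (1400 * (n * ε)) * Real.sqrt d := by nlinarith
    exact le_of_mul_le_mul_right this hs
  calc (d : ℝ) = Real.sqrt d ^ 2 := hsq.symm
    _ ≤ (1400 * (n * ε)) ^ 2 := by gcongr
    _ = _ := by ring

/-- If `d ≥ 600 n ε`, then `exp (2 n ε) ≤ exp (d / 300) < (4 / 3) ^ d ≤ 2 / 3 * 2 ^ d`, against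
packing. -/
theorem IsPrivateMarginals.lt_of_pure
    (h : IsPrivateMarginals M Q (Real.exp (2 * ε)) 0 α) (hd : 0 < d) (hα : α < n / 2) :
    (d : ℝ) < 600 * (n * ε) := by
  by_contra hcon
  push Not at hcon
  have hmain := h.two_pow_le_of_pure (Real.exp_pos _).le hα
  have h1 : Real.exp (2 * ε) ^ n ≤ Real.exp (1 / 300) ^ d := by
    rw [← Real.exp_nat_mul, ← Real.exp_nat_mul, Real.exp_le_exp]
    linarith
  have h2 : Real.exp (1 / 300) < 4 / 3 := by
    have h3 : Real.exp (1 / 300) ≤ Real.exp (2 * (1 / 600)) := by norm_num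
    have h4 := exp_two_mul_sub_one_le (ε := 1 / 600) (by norm_num) (by norm_num)
    linarith
  have h3 : Real.exp (1 / 300) ^ d < (4 / 3 : ℝ) ^ d :=
    pow_lt_pow_left₀ h2 (Real.exp_pos _).le hd.ne'
  have h4 : (4 / 3 : ℝ) ^ d * (3 / 2) ≤ 2 ^ d := by
    calc (4 / 3 : ℝ) ^ d * (3 / 2) ≤ (4 / 3 : ℝ) ^ d * (3 / 2) ^ d := by
          gcongr
          exact le_self_pow₀ (by norm_num) hd.ne'
      _ = 2 ^ d := by rw [← mul_pow]; norm_num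
  linarith

end Marginals

/-- Ensures at least one record later on: `log₂ T ≤ 8 T ^ (1 / 4)` makes the quotient at least `T ^
(1 / 6) / 4`. -/
theorem rpow_div_logb_ge {ε : ℝ} (hε0 : 0 < ε) (hε1 : ε ≤ 1) {T : ℕ} (hT : 1600 ^ 6 ≤ T) :
    400 ≤ (T : ℝ) ^ (1 / 3 : ℝ) / (ε ^ (2 / 3 : ℝ) * Real.logb 2 (T : ℝ) ^ (2 / 3 : ℝ)) := by
  have hT' : (1600 : ℝ) ^ 6 ≤ T := by exact_mod_cast hT
  have hT1 : (1 : ℝ) < T := lt_of_lt_of_le (by norm_num) hT'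
  have hT0 : (0 : ℝ) < T := by linarith
  have hL0 : 0 < Real.logb 2 (T : ℝ) := Real.logb_pos (by norm_num) hT1
  have hL : Real.logb 2 (T : ℝ) ≤ 8 * (T : ℝ) ^ (1 / 4 : ℝ) := by
    have h1 := Real.log_le_rpow_div hT0.le (ε := 1 / 4) (by norm_num)
    have h2 := Real.log_two_gt_d9
    have h3 : 0 < (T : ℝ) ^ (1 / 4 : ℝ) := by positivity
    rw [Real.logb, div_le_iff₀ (by linarith)]
    nlinarith
  have hLp : Real.logb 2 (T : ℝ) ^ (2 / 3 : ℝ) ≤ 4 * (T : ℝ) ^ (1 / 6 : ℝ) := by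
    calc Real.logb 2 (T : ℝ) ^ (2 / 3 : ℝ) ≤ (8 * (T : ℝ) ^ (1 / 4 : ℝ)) ^ (2 / 3 : ℝ) := by
          gcongr
      _ = 4 * (T : ℝ) ^ (1 / 6 : ℝ) := by
          rw [Real.mul_rpow (by norm_num) (by positivity), ← Real.rpow_mul hT0.le]
          rw [show (8 : ℝ) = 2 ^ (3 : ℝ) by norm_num, ← Real.rpow_mul (by norm_num)]
          norm_num
  have hεp : ε ^ (2 / 3 : ℝ) ≤ 1 := Real.rpow_le_one hε0.le hε1 (by norm_num)
  have h6 : (1600 : ℝ) ≤ (T : ℝ) ^ (1 / 6 : ℝ) := by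
    calc (1600 : ℝ) = ((1600 : ℝ) ^ 6) ^ (1 / 6 : ℝ) := by
          rw [← Real.rpow_natCast, ← Real.rpow_mul (by norm_num)]
          norm_num
      _ ≤ _ := by gcongr
  have h3 : (T : ℝ) ^ (1 / 3 : ℝ) = (T : ℝ) ^ (1 / 6 : ℝ) * (T : ℝ) ^ (1 / 6 : ℝ) := by
    rw [← Real.rpow_add hT0]; norm_num
  have hLp0 : 0 < Real.logb 2 (T : ℝ) ^ (2 / 3 : ℝ) := by positivity
  rw [le_div_iff₀ (by positivity), h3]
  calc 400 * (ε ^ (2 / 3 : ℝ) * Real.logb 2 (T : ℝ) ^ (2 / 3 : ℝ))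
      ≤ 400 * (1 * (4 * (T : ℝ) ^ (1 / 6 : ℝ))) := by gcongr
    _ = 1600 * (T : ℝ) ^ (1 / 6 : ℝ) := by ring
    _ ≤ _ := by gcongr

/-- The logarithm is simply discarded, being at least 1. -/
theorem pow_three_le_of_le_rpow_div_logb {ε x : ℝ} (hε0 : 0 < ε) {T : ℕ} (hT : 2 ≤ T) (hx : 0 ≤ x)
    (h : x ≤ (T : ℝ) ^ (1 / 3 : ℝ) / (ε ^ (2 / 3 : ℝ) * Real.logb 2 (T : ℝ) ^ (2 / 3 : ℝ))) :
    x ^ 3 * ε ^ 2 ≤ T := by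
  have hT' : (2 : ℝ) ≤ T := by exact_mod_cast hT
  have hL : 1 ≤ Real.logb 2 (T : ℝ) := by
    rw [Real.le_logb_iff_rpow_le (by norm_num) (by linarith)]
    simpa using hT'
  have hLp : 1 ≤ Real.logb 2 (T : ℝ) ^ (2 / 3 : ℝ) := Real.one_le_rpow hL (by norm_num)
  have hε : 0 < ε ^ (2 / 3 : ℝ) := by positivity
  have h1 : x * ε ^ (2 / 3 : ℝ) ≤ (T : ℝ) ^ (1 / 3 : ℝ) := by
    rw [le_div_iff₀ (by positivity)] at h
    refine le_trans ?_ h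
    gcongr
    exact le_mul_of_one_le_right hε.le hLp
  calc x ^ 3 * ε ^ 2 = (x * ε ^ (2 / 3 : ℝ)) ^ 3 := by
        rw [mul_pow, ← Real.rpow_natCast (ε ^ (2 / 3 : ℝ)), ← Real.rpow_mul hε0.le]
        norm_num
    _ ≤ ((T : ℝ) ^ (1 / 3 : ℝ)) ^ 3 := by gcongr
    _ = T := by
        rw [← Real.rpow_natCast, ← Real.rpow_mul (by linarith)]
        norm_num

/-! ### The two lower bounds -/

theorem approx_lower_bound (P : GraphProblem) {ε : ℝ} (hε0 : 0 < ε) (hε1 : ε ≤ 1) :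
    ∃ T₀ N₀ : ℕ, ∀ T N : ℕ, T₀ ≤ T → N₀ ≤ N → ∀ γ δ : ℝ, 0 ≤ γ → γ ≤ δ → T * δ ≤ 1 / 2800 →
      ∀ (A : ContinualReleaseAlgorithm (Fin N) T (P.dim N)) (α : ℝ),
        A.IsOutputDetermined (P.value N) γ → A.IsEventLevelEdgeDP ε δ →
        A.IsAccurate (P.value N) α (1 / 3) →
        1 / 80000 * min ((T : ℝ) ^ (1 / 3 : ℝ) /
            (ε ^ (2 / 3 : ℝ) * Real.logb 2 (T : ℝ) ^ (2 / 3 : ℝ)))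
          (min (T : ℝ) (N : ℝ)) ≤ α := by
  obtain ⟨K, hK⟩ := Gadget.exists_isHiding P
  obtain ⟨R, hR⟩ := exists_nat_gt (64 * (K : ℝ) ^ 3 / ε ^ 2)
  refine ⟨max (1600 ^ 6) (max R (4 * (K + 1))), max 400 (2 * K), fun T N hT hN γ δ hγ hγδ hTδ A α
    hdet hdp hacc => ?_⟩
  obtain ⟨hT1, hT2⟩ := max_le_iff.1 hT
  obtain ⟨hTR, hTK⟩ := max_le_iff.1 hT2
  obtain ⟨hN1, hN2⟩ := max_le_iff.1 hN
  by_contra hα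
  push Not at hα
  set Y := (T : ℝ) ^ (1 / 3 : ℝ) / (ε ^ (2 / 3 : ℝ) * Real.logb 2 (T : ℝ) ^ (2 / 3 : ℝ)) with hY
  set X := min Y (min (T : ℝ) (N : ℝ)) with hX
  have hT400 : (400 : ℝ) ≤ T := by
    have : 400 ≤ T := le_trans (by norm_num) hT1
    exact_mod_cast this
  have hX400 : 400 ≤ X := le_min (rpow_div_logb_ge hε0 hε1 hT1)
    (le_min hT400 (by exact_mod_cast hN1))
  have hXT : X ≤ T := (min_le_right _ _).trans (min_le_left _ _)
  have hXN : X ≤ N := (min_le_right _ _).trans (min_le_right _ _)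
  -- Rounding gives `n ≥ X / 800`, so `α < X / 80000 ≤ n / 100`, as fingerprinting requires.
  set n := ⌊X / 400⌋₊ with hn
  have hn1 : (n : ℝ) ≤ X / 400 := Nat.floor_le (by linarith)
  have hn2 : X / 400 / 2 ≤ n := half_le_floor (by linarith)
  have hn0 : 0 < n := Nat.floor_pos.2 (by linarith)
  have hn0' : (0 : ℝ) < n := by exact_mod_cast hn0
  have hX3 : X ^ 3 * ε ^ 2 ≤ T := pow_three_le_of_le_rpow_div_logb hε0
    (le_trans (by norm_num) hT1) (by linarith) (min_le_left _ _)
  have hn3 : 64000000 * ((n : ℝ) ^ 3 * ε ^ 2) ≤ T := by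
    calc 64000000 * ((n : ℝ) ^ 3 * ε ^ 2) ≤ 64000000 * ((X / 400) ^ 3 * ε ^ 2) := by gcongr
      _ = X ^ 3 * ε ^ 2 := by ring
      _ ≤ T := hX3
  -- Setup time is negligible: `n` is at most of order `(T / ε ^ 2) ^ (1 / 3)`, so `K n ≤ T / 4`
  -- once `T` exceeds a threshold in `K` and `ε`.
  have hKn : 4 * (K * n) ≤ T := by
    by_contra hcon
    push Not at hcon
    have hcon' : (T : ℝ) < 4 * (K * n) := by exact_mod_cast hcon
    have h1 : (T : ℝ) ^ 3 * ε ^ 2 ≤ (4 * (K * n)) ^ 3 * ε ^ 2 := by gcongr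
    have h2 : 64 * (K : ℝ) ^ 3 < T * ε ^ 2 := by
      rw [← div_lt_iff₀ (by positivity)]
      exact hR.trans_le (by exact_mod_cast hTR)
    have h3 : (64 * (K : ℝ) ^ 3) * ((n : ℝ) ^ 3 * ε ^ 2) ≤ (T * ε ^ 2) * T := by
      have hnn : (n : ℝ) ^ 3 * ε ^ 2 ≤ T := by
        have : 0 ≤ (n : ℝ) ^ 3 * ε ^ 2 := by positivity
        linarith
      gcongr
    have h4 : (T : ℝ) ^ 3 * ε ^ 2 ≤ (T : ℝ) ^ 2 * ε ^ 2 := by nlinarith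
    have h5 : 0 < (T : ℝ) ^ 2 * ε ^ 2 := by positivity
    nlinarith
  have hnT : 8 * n ≤ T := by
    have : (8 * n : ℝ) ≤ T := by linarith
    exact_mod_cast this
  have hnN : 4 * n + K ≤ N := by
    have : (8 * n : ℝ) ≤ N := by linarith
    have : 8 * n ≤ N := by exact_mod_cast this
    omega
  obtain ⟨hd1, hd2, hd3⟩ := phases_bounds hn0 hnT
  set d := T / (8 * n) with hd
  obtain ⟨g, hsize, hhide, m, C, hC⟩ := hK N n hnN
  have hlen : g.size + 1 + 2 * n * d ≤ T := by
    rw [mul_assoc]; omega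
  have hM := hhide.isPrivateMarginals hlen hC hdet hdp hacc
  have hδ0 : 0 ≤ δ := hγ.trans hγδ
  have he : Real.exp ε ≤ 3 := by
    have := Real.exp_one_lt_d9
    have := Real.exp_le_exp.2 hε1
    linarith
  have he0 := Real.exp_pos ε
  have hδ' : Real.exp ε * (δ + γ) + δ ≤ 7 * δ := by nlinarith
  have hδ'0 : 0 ≤ Real.exp ε * (δ + γ) + δ := by positivity
  have hnδ : n * (Real.exp ε * (δ + γ) + δ) ≤ 1 / 400 := by
    have : (n : ℝ) ≤ T := by linarith
    calc n * (Real.exp ε * (δ + γ) + δ) ≤ T * (7 * δ) := by gcongr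
      _ ≤ _ := by linarith
  have hfin := hM.le_of_approx hε0.le hε1 hδ'0 hnδ hn0 hd1 (by linarith)
  have hd3' : (T : ℝ) ≤ 16 * (n * d) := by exact_mod_cast hd3
  have : (n : ℝ) * d ≤ n * (1960000 * (n ^ 2 * ε ^ 2)) := by gcongr
  have hpos : 0 < (n : ℝ) ^ 3 * ε ^ 2 := by positivity
  -- Contradiction: `64000000 n³ε² ≤ T ≤ 16 n d ≤ 31360000 n³ε²`.
  nlinarith

theorem pure_lower_bound (P : GraphProblem) {ε : ℝ} (hε0 : 0 < ε) (hε1 : ε ≤ 1) :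
    ∃ T₀ N₀ : ℕ, ∀ T N : ℕ, T₀ ≤ T → N₀ ≤ N →
      ∀ (A : ContinualReleaseAlgorithm (Fin N) T (P.dim N)) (α : ℝ),
        A.IsOutputDetermined (P.value N) 0 → A.IsEventLevelEdgeDP ε 0 →
        A.IsAccurate (P.value N) α (1 / 3) →
        1 / 80000 * min (Real.sqrt ((T : ℝ) / ε)) (min (T : ℝ) (N : ℝ)) ≤ α := by
  obtain ⟨K, hK⟩ := Gadget.exists_isHiding P
  obtain ⟨R, hR⟩ := exists_nat_gt (16 * (K : ℝ) ^ 2 / ε)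
  refine ⟨max 10000 (max R (4 * (K + 1))), max 100 (2 * K), fun T N hT hN A α
    hdet hdp hacc => ?_⟩
  obtain ⟨hT1, hT2⟩ := max_le_iff.1 hT
  obtain ⟨hTR, hTK⟩ := max_le_iff.1 hT2
  obtain ⟨hN1, hN2⟩ := max_le_iff.1 hN
  by_contra hα
  push Not at hα
  set X := min (Real.sqrt ((T : ℝ) / ε)) (min (T : ℝ) (N : ℝ)) with hX
  have hT1' : (10000 : ℝ) ≤ T := by exact_mod_cast hT1
  have hX100 : 100 ≤ X := by
    refine le_min (Real.le_sqrt_of_sq_le ?_) (le_min (by linarith) (by exact_mod_cast hN1))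
    rw [le_div_iff₀ hε0]
    nlinarith
  have hXT : X ≤ T := (min_le_right _ _).trans (min_le_left _ _)
  have hXN : X ≤ N := (min_le_right _ _).trans (min_le_right _ _)
  set n := ⌊X / 100⌋₊ with hn
  have hn1 : (n : ℝ) ≤ X / 100 := Nat.floor_le (by linarith)
  have hn2 : X / 100 / 2 ≤ n := half_le_floor (by linarith)
  have hn0 : 0 < n := Nat.floor_pos.2 (by linarith)
  have hn0' : (0 : ℝ) < n := by exact_mod_cast hn0
  have hX2 : X ^ 2 * ε ≤ T := by
    have h1 : X ^ 2 ≤ Real.sqrt ((T : ℝ) / ε) ^ 2 := by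
      have := min_le_left (Real.sqrt ((T : ℝ) / ε)) (min (T : ℝ) (N : ℝ))
      gcongr
    rw [Real.sq_sqrt (by positivity), le_div_iff₀ hε0] at h1
    exact h1
  have hn3 : 10000 * ((n : ℝ) ^ 2 * ε) ≤ T := by
    calc 10000 * ((n : ℝ) ^ 2 * ε) ≤ 10000 * ((X / 100) ^ 2 * ε) := by gcongr
      _ = X ^ 2 * ε := by ring
      _ ≤ T := hX2
  have hKn : 4 * (K * n) ≤ T := by
    by_contra hcon
    push Not at hcon
    have hcon' : (T : ℝ) < 4 * (K * n) := by exact_mod_cast hcon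
    have h1 : (T : ℝ) ^ 2 * ε ≤ (4 * (K * n)) ^ 2 * ε := by gcongr
    have h2 : 16 * (K : ℝ) ^ 2 < T * ε := by
      rw [← div_lt_iff₀ (by positivity)]
      exact hR.trans_le (by exact_mod_cast hTR)
    have h3 : (16 * (K : ℝ) ^ 2) * (10000 * ((n : ℝ) ^ 2 * ε)) ≤ (T * ε) * T := by gcongr
    have h5 : 0 < (T : ℝ) ^ 2 * ε := by positivity
    nlinarith
  have hnT : 8 * n ≤ T := by
    have : (8 * n : ℝ) ≤ T := by linarith
    exact_mod_cast this
  have hnN : 4 * n + K ≤ N := by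
    have : (8 * n : ℝ) ≤ N := by linarith
    have : 8 * n ≤ N := by exact_mod_cast this
    omega
  obtain ⟨hd1, hd2, hd3⟩ := phases_bounds hn0 hnT
  set d := T / (8 * n) with hd
  obtain ⟨g, hsize, hhide, m, C, hC⟩ := hK N n hnN
  have hlen : g.size + 1 + 2 * n * d ≤ T := by
    rw [mul_assoc]; omega
  have hM := hhide.isPrivateMarginals hlen hC hdet hdp hacc
  rw [show Real.exp ε * (0 + 0) + 0 = (0 : ℝ) by ring] at hM
  have hfin := hM.lt_of_pure hd1 (by linarith)
  have hd3' : (T : ℝ) ≤ 16 * (n * d) := by exact_mod_cast hd3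
  have : (n : ℝ) * d < n * (600 * (n * ε)) := by gcongr
  have hpos : 0 < (n : ℝ) ^ 2 * ε := by positivity
  -- Contradiction: `10000 n²ε ≤ T ≤ 16 n d < 9600 n²ε`.
  nlinarith

theorem mainTheorem9 :
    ∃ c : ℝ, 0 < c ∧ ∀ (P : GraphProblem) (ε : ℝ), 0 < ε → ε ≤ 1 →
      -- approximate differential privacy, with `δ = o(1/T)` as `T` and `N` grow
      (∀ δ : ℕ → ℕ → ℝ, (∀ T N, 0 < δ T N ∧ δ T N < 1) →
        Asymptotics.IsLittleO Filter.atTop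
          (fun p : ℕ × ℕ => δ p.1 p.2) (fun p : ℕ × ℕ => 1 / (p.1 : ℝ)) →
        ∃ T₀ N₀ : ℕ, ∀ T N : ℕ, T₀ ≤ T → N₀ ≤ N →
          ∀ γ : ℝ, 0 ≤ γ → γ ≤ δ T N →
          ∀ (A : ContinualReleaseAlgorithm (Fin N) T (P.dim N)) (α : ℝ),
            A.IsOutputDetermined (P.value N) γ →
            A.IsEventLevelEdgeDP ε (δ T N) →
            A.IsAccurate (P.value N) α (1 / 3) →
            c * min ((T : ℝ) ^ (1 / 3 : ℝ) /
                (ε ^ (2 / 3 : ℝ) * Real.logb 2 (T : ℝ) ^ (2 / 3 : ℝ)))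
              (min (T : ℝ) (N : ℝ)) ≤ α) ∧
      -- pure differential privacy, `δ = 0` (hence `γ = 0`)
      (∃ T₀ N₀ : ℕ, ∀ T N : ℕ, T₀ ≤ T → N₀ ≤ N →
        ∀ (A : ContinualReleaseAlgorithm (Fin N) T (P.dim N)) (α : ℝ),
          A.IsOutputDetermined (P.value N) 0 →
          A.IsEventLevelEdgeDP ε 0 →
          A.IsAccurate (P.value N) α (1 / 3) →
          c * min (Real.sqrt ((T : ℝ) / ε)) (min (T : ℝ) (N : ℝ)) ≤ α) := by
  refine ⟨1 / 80000, by norm_num, fun P ε hε0 hε1 => ⟨fun δ hδ hlo => ?_, ?_⟩⟩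
  · obtain ⟨T₁, N₁, h⟩ := approx_lower_bound P hε0 hε1
    -- The little-o hypothesis enters only as `T * δ ≤ 1 / 2800`: the marginals mechanism has
    -- additive loss at most `7 δ`, and `7 / 2800 = 1 / 400`.
    obtain ⟨⟨T₂, N₂⟩, h2⟩ := Filter.eventually_atTop.1
      (hlo.bound (show (0 : ℝ) < 1 / 2800 by norm_num))
    refine ⟨max (max T₁ T₂) 1, max N₁ N₂, fun T N hT hN γ hγ0 hγ A α hdet hdp hacc => ?_⟩
    obtain ⟨hT', hT1⟩ := max_le_iff.1 hT
    refine h T N ((le_max_left _ _).trans hT') ((le_max_left _ _).trans hN) γ (δ T N) hγ0 hγ ?_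
      A α hdet hdp hacc
    have hb := h2 (T, N) ⟨(le_max_right _ _).trans hT', (le_max_right _ _).trans hN⟩
    have hT0 : (0 : ℝ) < T := by exact_mod_cast hT1
    rw [Real.norm_of_nonneg (hδ T N).1.le, Real.norm_of_nonneg (by positivity),
      mul_one_div, le_div_iff₀ hT0] at hb
    linarith
  · exact pure_lower_bound P hε0 hε1
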